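/- Let $X$ be a connected, locally connected, paracompact Hausdorff space and let $E\to X$ be a locally trivial real vector bundle of finite rank $n$. A non-degenerate quadratic form on $E$ is a continuous function $q\colon E\to\mathbb{R}$ whose restriction to each fibre $E_x$ is a non-degenerate quadratic form; it has inertia $(n_+,n_-)$ if, on every fibre, the maximal dimensions of a positive definite and of a negative definite subspace are $n_+$ and $n_-$. A splitting of $E$ is an ordered pair $(E',E'')$ of vector subbundles with $E=E'\oplus E''$; two splittings $(E'_0,E''_0)$ and $(E'_1,E''_1)$ are isomorphic if there are vector bundle isomorphisms $E'_0\cong E'_1$ and $E''_0\cong E''_1$ over $X$. A $q$-splitting is a splitting $(E^+,E^-)$ with $q|_{E^+}$ positive definite and $q|_{E^-}$ negative definite. Every non-degenerate quadratic form $q$ on $E$ has a $q$-splitting, and all $q$-splittings are isomorphic as splittings; let $\theta_\simeq(q)$ denote their common isomorphism class. For $q$ of inertia $(n_+,n_-)$ let $\mathrm{Fr}_q(E)\to X$ be the principal $O(n_+,n_-)$-bundle of $q$-orthonormal frames, that is, of bases of the fibres in which the Gram matrix of the symmetric bilinear form of $q$ is $\mathrm{diag}(1,\dots,1,-1,\dots,-1)$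 with $n_+$ entries $1$ and $n_-$ entries $-1$. Then, for any two non-degenerate quadratic forms $q_0,q_1$ on $E$, $$\theta_\simeq(q_0)=\theta_\simeq(q_1)\iff \mathrm{Fr}_{q_0}(E)\simeq\mathrm{Fr}_{q_1}(E),$$ where $\mathrm{Fr}_{q_0}(E)\simeq\mathrm{Fr}_{q_1}(E)$ means that $q_0$ and $q_1$ have the same inertia $(n_+,n_-)$ and that there is an isomorphism of principal $O(n_+,n_-)$-bundles over $X$ (an $O(n_+,n_-)$-equivariant homeomorphism covering the identity of $X$) between their frame bundles. -/

import Mathlib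

open Bundle
open scoped MulOpposite

noncomputable section

namespace BundleSylvester

section Forms

variable {X : Type*} (F : Type*) (E : X → Type*) [TopologicalSpace (TotalSpace F E)]
  [∀ x, AddCommGroup (E x)] [∀ x, Module ℝ (E x)]

/-- A non-degenerate quadratic form on the real vector bundle `E`: a non-degenerate quadratic form
on each fibre such that the resulting function on the total space is continuous. -/
structure NondegQuadForm where
  form : ∀ x, QuadraticForm ℝ (E x)
  nondegenerate : ∀ x, (QuadraticMap.associated (R := ℝ) (form x)).SeparatingLeft
  continuous_form : Continuous fun v : TotalSpace F E => form v.proj v.snd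

variable {F E}

/-- The form `q` has inertia `(p, m)` on every fibre: `p` and `m` are the largest dimensions of a
positive definite and of a negative definite subspace. -/
def NondegQuadForm.HasInertia (q : NondegQuadForm F E) (p m : ℕ) : Prop :=
  ∀ x, sigPos (q.form x) = p ∧ sigNeg (q.form x) = m

end Forms

section SubbundleIso

variable {X : Type*} (F : Type*) {E : X → Type*} [TopologicalSpace (TotalSpace F E)]
  [∀ x, AddCommGroup (E x)] [∀ x, Module ℝ (E x)]

/-- The total space of a family of subspaces, topologized as a subspace of the total space of
`E`. -/
abbrev SubTotal (S : ∀ x, Submodule ℝ (E x)) : Type _ :=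
  {v : TotalSpace F E // v.snd ∈ S v.proj}

/-- The map on total spaces induced by a family of linear isomorphisms between subspaces of the
fibres. -/
def SubTotal.map {S T : ∀ x, Submodule ℝ (E x)} (f : ∀ x, S x ≃ₗ[ℝ] T x) (v : SubTotal F S) :
    SubTotal F T :=
  ⟨⟨v.1.proj, (f v.1.proj ⟨v.1.snd, v.2⟩ : T v.1.proj)⟩, (f v.1.proj ⟨v.1.snd, v.2⟩).2⟩

/-- Isomorphism of vector subbundles as vector bundles over the base: there are linear isomorphisms
of the fibres which are continuous, together with their inverses, on the total spaces. -/
def SubbundlesIsomorphic (S T : ∀ x, Submodule ℝ (E x)) : Prop :=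
  ∃ f : ∀ x, S x ≃ₗ[ℝ] T x, Continuous (SubTotal.map F f) ∧
    Continuous (SubTotal.map F fun x => (f x).symm)

variable {F}

theorem SubbundlesIsomorphic.refl (S : ∀ x, Submodule ℝ (E x)) : SubbundlesIsomorphic F S S :=
  ⟨fun x => LinearEquiv.refl ℝ (S x), continuous_id, continuous_id⟩

theorem SubbundlesIsomorphic.symm {S T : ∀ x, Submodule ℝ (E x)}
    (h : SubbundlesIsomorphic F S T) : SubbundlesIsomorphic F T S := by
  obtain ⟨f, h₁, h₂⟩ := h
  exact ⟨fun x => (f x).symm, h₂, h₁⟩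

theorem SubbundlesIsomorphic.trans {S T U : ∀ x, Submodule ℝ (E x)}
    (h : SubbundlesIsomorphic F S T) (h' : SubbundlesIsomorphic F T U) :
    SubbundlesIsomorphic F S U := by
  obtain ⟨f, h₁, h₂⟩ := h
  obtain ⟨g, h₃, h₄⟩ := h'
  exact ⟨fun x => (f x).trans (g x), h₃.comp h₁, h₂.comp h₄⟩

end SubbundleIso

section Splittings

variable {X : Type*} [TopologicalSpace X]
  (F : Type*) [NormedAddCommGroup F] [NormedSpace ℝ F]
  (E : X → Type*) [TopologicalSpace (TotalSpace F E)]
  [∀ x, AddCommGroup (E x)] [∀ x, Module ℝ (E x)]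

variable {E} in
/-- A family of subspaces of the fibres is a vector subbundle of `E` if around every point there is
a linear local trivialization of `E` which identifies the family with a constant subspace `W` of
the model fibre. -/
def IsSubbundle (S : ∀ x, Submodule ℝ (E x)) : Prop :=
  ∀ x₀ : X, ∃ e : Trivialization F (π F E), e.IsLinear ℝ ∧ x₀ ∈ e.baseSet ∧
    ∃ W : Submodule ℝ F, ∀ x ∈ e.baseSet, ∀ v : E x,
      v ∈ S x ↔ (e (⟨x, v⟩ : TotalSpace F E)).2 ∈ W

/-- A splitting of `E`: an ordered pair of vector subbundles with `E = fst ⊕ snd`. -/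
structure Splitting where
  fst : ∀ x, Submodule ℝ (E x)
  snd : ∀ x, Submodule ℝ (E x)
  isSubbundle_fst : IsSubbundle F fst
  isSubbundle_snd : IsSubbundle F snd
  isCompl : ∀ x, IsCompl (fst x) (snd x)

/-- Isomorphism of splittings: the first summands are isomorphic vector bundles, and so are the
second ones. -/
instance Splitting.isoSetoid : Setoid (Splitting F E) where
  r S T := SubbundlesIsomorphic F S.fst T.fst ∧ SubbundlesIsomorphic F S.snd T.snd
  iseqv :=
    { refl := fun S => ⟨.refl S.fst, .refl S.snd⟩
      symm := fun h => ⟨h.1.symm, h.2.symm⟩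
      trans := fun h h' => ⟨h.1.trans h'.1, h.2.trans h'.2⟩ }

/-- The set of isomorphism classes of splittings of `E`. -/
abbrev SplittingClass : Type _ := Quotient (Splitting.isoSetoid F E)

variable {F E}

/-- `S` is a `q`-splitting: `q` is positive definite on the first summand and negative definite on
the second one. -/
def NondegQuadForm.IsSplitting (q : NondegQuadForm F E) (S : Splitting F E) : Prop :=
  ∀ x, (∀ v ∈ S.fst x, v ≠ 0 → 0 < q.form x v) ∧ (∀ v ∈ S.snd x, v ≠ 0 → q.form x v < 0)

end Splittings

section Theta

variable {X : Type*} [TopologicalSpace X]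
  {F : Type*} [NormedAddCommGroup F] [NormedSpace ℝ F]
  {E : X → Type*} [TopologicalSpace (TotalSpace F E)]
  [∀ x, AddCommGroup (E x)] [∀ x, Module ℝ (E x)]
  [∀ x, TopologicalSpace (E x)] [FiberBundle F E] [VectorBundle ℝ F E]

variable (F E) in
/-- The trivial splitting `(E, 0)`. -/
def Splitting.trivial : Splitting F E where
  fst _ := ⊤
  snd _ := ⊥
  isSubbundle_fst x₀ := ⟨trivializationAt F E x₀, inferInstance,
    FiberBundle.mem_baseSet_trivializationAt F E x₀, ⊤, by simp⟩
  isSubbundle_snd x₀ := by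
    refine ⟨trivializationAt F E x₀, inferInstance,
      FiberBundle.mem_baseSet_trivializationAt F E x₀, ⊥, fun x hx v => ?_⟩
    rw [Submodule.mem_bot, Submodule.mem_bot,
      ← Trivialization.linearEquivAt_apply (R := ℝ) (trivializationAt F E x₀) x hx]
    simp only [LinearEquiv.map_eq_zero_iff]
  isCompl _ := isCompl_top_bot

open scoped Classical in
/-- The isomorphism class `θ(q)` of the `q`-splittings, read off from any one of them (with the
class of `(E, 0)` as a default if there were none). -/
def NondegQuadForm.theta (q : NondegQuadForm F E) : SplittingClass F E :=
  if h : ∃ S : Splitting F E, q.IsSplitting S then Quotient.mk _ h.choose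
  else Quotient.mk _ (Splitting.trivial F E)

end Theta

section Orthogonal

/-- The Gram matrix `diag(1, …, 1, -1, …, -1)` with `p` entries `1` and `m` entries `-1`. -/
abbrev signMatrix (p m : ℕ) : Matrix (Fin p ⊕ Fin m) (Fin p ⊕ Fin m) ℝ :=
  LieAlgebra.Orthogonal.indefiniteDiagonal (Fin p) (Fin m) ℝ

/-- The indefinite orthogonal group `O(p, m)`: the real matrices `g` with `gᵀ η g = η`, where
`η = diag(1, …, 1, -1, …, -1)`. -/
def indefiniteOrthogonalGroup (p m : ℕ) : Subgroup (GL (Fin p ⊕ Fin m) ℝ) where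
  carrier := {g | g.1.transpose * signMatrix p m * g.1 = signMatrix p m}
  one_mem' := by simp
  mul_mem' := by
    intro a b ha hb
    simp only [Set.mem_ofPred_eq] at ha hb ⊢
    calc (a * b).1.transpose * signMatrix p m * (a * b).1
        = b.1.transpose * (a.1.transpose * signMatrix p m * a.1) * b.1 := by
          simp [Matrix.transpose_mul, Matrix.mul_assoc]
      _ = signMatrix p m := by rw [ha, hb]
  inv_mem' := by
    intro a ha
    simp only [Set.mem_ofPred_eq] at ha ⊢
    have h₁ : a.1 * (a⁻¹).1 = 1 := by rw [← Units.val_mul, mul_inv_cancel, Units.val_one]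
    have h₂ : (a⁻¹).1.transpose * a.1.transpose = 1 := by
      rw [← Matrix.transpose_mul, h₁, Matrix.transpose_one]
    calc (a⁻¹).1.transpose * signMatrix p m * (a⁻¹).1
        = (a⁻¹).1.transpose * (a.1.transpose * signMatrix p m * a.1) * (a⁻¹).1 := by rw [ha]
      _ = ((a⁻¹).1.transpose * a.1.transpose) * signMatrix p m * (a.1 * (a⁻¹).1) := by
          simp only [Matrix.mul_assoc]
      _ = signMatrix p m := by rw [h₁, h₂, one_mul, mul_one]

end Orthogonal

section Frames

variable {X : Type*} {F : Type*} {E : X → Type*} [TopologicalSpace (TotalSpace F E)]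
  [∀ x, AddCommGroup (E x)] [∀ x, Module ℝ (E x)]

/-- The total space of the bundle of `q`-orthonormal frames, for `q` of inertia `(p, m)`: a point
`base` of `X` with a basis of the fibre whose Gram matrix with respect to the symmetric bilinear
form of `q` is `diag(1, …, 1, -1, …, -1)`. -/
@[ext]
structure OrthoFrame (q : NondegQuadForm F E) (p m : ℕ) where
  base : X
  basis : Module.Basis (Fin p ⊕ Fin m) ℝ (E base)
  orthonormal : ∀ i j,
    QuadraticMap.associated (R := ℝ) (q.form base) (basis i) (basis j) = signMatrix p m i j

namespace OrthoFrame

variable {q : NondegQuadForm F E} {p m : ℕ}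

/-- A frame is topologized as a point of `X` together with a tuple of points of `E`. -/
instance [TopologicalSpace X] : TopologicalSpace (OrthoFrame q p m) :=
  TopologicalSpace.induced
    (fun f => ((f.base, fun i => ⟨f.base, f.basis i⟩) : X × (Fin p ⊕ Fin m → TotalSpace F E)))
    inferInstance

/-- The basis `e g` with `(e g)ⱼ = ∑ᵢ gᵢⱼ eᵢ`. -/
def basisMul {V : Type*} [AddCommGroup V] [Module ℝ V] (e : Module.Basis (Fin p ⊕ Fin m) ℝ V)
    (g : GL (Fin p ⊕ Fin m) ℝ) : Module.Basis (Fin p ⊕ Fin m) ℝ V :=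
  e.map (Matrix.toLinearEquiv e g.1 ((Matrix.isUnit_iff_isUnit_det _).1 g.isUnit))

theorem basisMul_apply {V : Type*} [AddCommGroup V] [Module ℝ V]
    (e : Module.Basis (Fin p ⊕ Fin m) ℝ V) (g : GL (Fin p ⊕ Fin m) ℝ) (j : Fin p ⊕ Fin m) :
    basisMul e g j = ∑ i, g.1 i j • e i := by
  simp only [basisMul, Module.Basis.map_apply]
  exact Matrix.toLin_self e e g.1 j

theorem basisMul_one {V : Type*} [AddCommGroup V] [Module ℝ V]
    (e : Module.Basis (Fin p ⊕ Fin m) ℝ V) : basisMul e 1 = e := by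
  refine Module.Basis.eq_of_apply_eq fun j => ?_
  simp [basisMul_apply, Matrix.one_apply]

theorem basisMul_mul {V : Type*} [AddCommGroup V] [Module ℝ V]
    (e : Module.Basis (Fin p ⊕ Fin m) ℝ V) (g h : GL (Fin p ⊕ Fin m) ℝ) :
    basisMul e (g * h) = basisMul (basisMul e g) h := by
  refine Module.Basis.eq_of_apply_eq fun j => ?_
  simp only [basisMul_apply, Units.val_mul, Matrix.mul_apply, Finset.sum_smul, Finset.smul_sum,
    smul_smul]
  rw [Finset.sum_comm]
  refine Finset.sum_congr rfl fun k _ => Finset.sum_congr rfl fun i _ => ?_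
  rw [mul_comm]

theorem basisMul_gram {V : Type*} [AddCommGroup V] [Module ℝ V]
    (B : V →ₗ[ℝ] V →ₗ[ℝ] ℝ) (e : Module.Basis (Fin p ⊕ Fin m) ℝ V)
    (he : ∀ i j, B (e i) (e j) = signMatrix p m i j) (g : indefiniteOrthogonalGroup p m)
    (i j : Fin p ⊕ Fin m) : B (basisMul e g.1 i) (basisMul e g.1 j) = signMatrix p m i j := by
  have hg : g.1.1.transpose * signMatrix p m * g.1.1 = signMatrix p m := g.2
  rw [← congrFun (congrFun hg i) j, basisMul_apply, basisMul_apply]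
  simp only [map_sum, map_smul, LinearMap.sum_apply, LinearMap.smul_apply, he,
    Matrix.mul_apply, Matrix.transpose_apply, smul_eq_mul, Finset.sum_mul, Finset.mul_sum]
  refine Finset.sum_congr rfl fun a _ => Finset.sum_congr rfl fun b _ => ?_
  ring

/-- The frame `f g`, for `g` in `O(p, m)`. -/
def act (f : OrthoFrame q p m) (g : indefiniteOrthogonalGroup p m) : OrthoFrame q p m where
  base := f.base
  basis := basisMul f.basis g.1
  orthonormal :=
    basisMul_gram (QuadraticMap.associated (R := ℝ) (q.form f.base)) f.basis f.orthonormal g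

theorem act_one (f : OrthoFrame q p m) : f.act 1 = f := by
  have h : basisMul f.basis (1 : indefiniteOrthogonalGroup p m).1 = f.basis := by
    rw [OneMemClass.coe_one, basisMul_one]
  exact OrthoFrame.ext rfl (heq_of_eq h)

theorem act_mul (f : OrthoFrame q p m) (g h : indefiniteOrthogonalGroup p m) :
    f.act (g * h) = (f.act g).act h := by
  have hm : basisMul f.basis (g * h).1 = basisMul (basisMul f.basis g.1) h.1 := by
    rw [Subgroup.coe_mul, basisMul_mul]
  exact OrthoFrame.ext rfl (heq_of_eq hm)

/-- The right action of `O(p, m)` on orthonormal frames. -/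
instance : MulAction (indefiniteOrthogonalGroup p m)ᵐᵒᵖ (OrthoFrame q p m) where
  smul g f := f.act g.unop
  one_smul f := act_one f
  mul_smul a b f := act_mul f b.unop a.unop

end OrthoFrame

/-- An isomorphism of principal `G`-bundles `π₁ : P₁ → X` and `π₂ : P₂ → X` (`G` acting from the
right): a homeomorphism of the total spaces over `X` which is `G`-equivariant. -/
structure PrincipalIso (G : Type*) [Group G] {X P₁ P₂ : Type*}
    [TopologicalSpace P₁] [TopologicalSpace P₂] [MulAction Gᵐᵒᵖ P₁] [MulAction Gᵐᵒᵖ P₂]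
    (π₁ : P₁ → X) (π₂ : P₂ → X) where
  toHomeomorph : P₁ ≃ₜ P₂
  proj_comp : ∀ u, π₂ (toHomeomorph u) = π₁ u
  equivariant : ∀ (g : G) (u : P₁),
    toHomeomorph (MulOpposite.op g • u) = MulOpposite.op g • toHomeomorph u

/-- The orthonormal frame bundles of `q₀` and `q₁` are isomorphic: `q₀` and `q₁` have the same
inertia `(p, m)`, so that both bundles have structure group `O(p, m)`, and they are isomorphic as
principal `O(p, m)`-bundles over `X`. -/
def FrameBundlesIsomorphic [TopologicalSpace X] (q₀ q₁ : NondegQuadForm F E) : Prop :=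
  ∃ p m : ℕ, q₀.HasInertia p m ∧ q₁.HasInertia p m ∧
    Nonempty (PrincipalIso (indefiniteOrthogonalGroup p m)
      (OrthoFrame.base : OrthoFrame q₀ p m → X) (OrthoFrame.base : OrthoFrame q₁ p m → X))

end Frames

end BundleSylvester

end

/-! Both conditions are equivalent to a third one: there is a continuous bundle automorphism `f` of
`E` with `q₁ (f ·) = q₀`.

The working notion is a polarization of `q`: a continuous family of `q`-orthogonal projections `P`
for which `q((2P - 1)·, ·)` is a metric. Its images and kernels form a `q`-splitting. A polarization
exists because `E` carries a metric `h` (partition of unity): if `A` represents `q` with respect to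
`h`, then `P` is the positive spectral projection `(1 + A|A|⁻¹)/2`. Two `q`-splittings with
projections `S` and `T` are matched by `TS + (1 - T)(1 - S)`, which is injective because a positive
and a negative definite subspace meet only in `0`.

Metrics are compared through the transport operator of `IsTransport`, the positive square root of
the operator representing `h'` with respect to `h`. It is unique, hence commutes with every operator
that is symmetric for both metrics, and hence depends continuously on the metrics: it stays bounded,
and all of its cluster points are again transport operators. In particular the transport between the
metrics of two forms with the same polarization `P` commutes with `P`, so it carries one form to the
other (`IsPolarization.map_transport`).

From equal classes to an isometry: an automorphism `g` matching the splittings gives `q₀` and `q₁ (g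
·)` a common polarization, and the transport `l` between their metrics makes `g ∘ l` an isometry.
Conversely an isometry conjugates a polarization of `q₀` into one of `q₁`.

An isometry acts on orthonormal frames, and on a connected base the inertia is constant. Conversely
an equivariant map of frame bundles sends the basis `s` of a fibre to a basis `Φ s`, and
equivariance makes the linear map with `s ↦ Φ s` independent of `s`. It is continuous because frames
continuous at a given point exist. -/

noncomputable section

namespace BundleSylvester

open Filter Topology

/-! ### Linear algebra of one fibre: transport operators and polarizations -/

section Algebra

variable {V : Type*} [AddCommGroup V] [Module ℝ V]

/-- A bilinear form which is symmetric and positive definite. -/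
structure IsMetric (h : LinearMap.BilinForm ℝ V) : Prop where
  symm : ∀ v w, h v w = h w v
  pos : ∀ v, v ≠ 0 → 0 < h v v

theorem IsMetric.nondegenerate {h : LinearMap.BilinForm ℝ V} (hh : IsMetric h) :
    h.Nondegenerate := by
  have key : ∀ v, h v v = 0 → v = 0 := fun v hv => by
    by_contra hne
    exact (hh.pos v hne).ne' hv
  exact ⟨fun v hv => key v (hv v), fun v hv => key v (hv v)⟩

theorem IsMetric.eq_of_forall {h : LinearMap.BilinForm ℝ V} (hh : IsMetric h) {v w : V}
    (H : ∀ u, h v u = h w u) : v = w := by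
  rw [← sub_eq_zero]
  refine hh.nondegenerate.1 _ fun u => ?_
  rw [map_sub, LinearMap.sub_apply, H, sub_self]

variable [FiniteDimensional ℝ V]

/-- A self-adjoint operator is diagonal in suitable orthonormal coordinates. -/
theorem IsMetric.exists_diagonalization {h : LinearMap.BilinForm ℝ V} (hh : IsMetric h)
    (T : V →ₗ[ℝ] V) (hT : ∀ v w, h (T v) w = h v (T w)) :
    ∃ (c : V ≃ₗ[ℝ] (Fin (Module.finrank ℝ V) → ℝ)) (μ : Fin (Module.finrank ℝ V) → ℝ),
      (∀ v w, h v w = ∑ i, c v i * c w i) ∧ ∀ v i, c (T v) i = μ i * c v i := by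
  -- The form `h` itself serves as inner product, so that the spectral theorem applies to `T`.
  let core : InnerProductSpace.Core ℝ V :=
    { inner := fun v w => h v w
      conj_inner_symm := fun v w => by simp [hh.symm v w]
      re_inner_nonneg := fun v => by
        rcases eq_or_ne v 0 with rfl | hv
        · simp
        · exact (hh.pos v hv).le
      add_left := fun u v w => by simp
      smul_left := fun u v r => by simp
      definite := fun v hv => by
        by_contra hne
        exact (hh.pos v hne).ne' hv }
  let : NormedAddCommGroup V := core.toNormedAddCommGroup
  let : InnerProductSpace ℝ V := InnerProductSpace.ofCore core.toCore
  have hin : ∀ v w : V, inner ℝ v w = h v w := fun _ _ => rfl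
  have hS : T.IsSymmetric := fun v w => hT v w
  let b := hS.eigenvectorBasis rfl
  refine ⟨b.toBasis.equivFun, hS.eigenvalues rfl, fun v w => ?_, fun v i => ?_⟩
  · rw [← hin, ← b.sum_inner_mul_inner v w]
    refine Finset.sum_congr rfl fun i _ => ?_
    simp [b.repr_apply_apply, real_inner_comm]
  · simpa using hS.eigenvectorBasis_apply_self_apply rfl v i

/-- A Sylvester equation with positive coefficients has only the zero solution. -/
theorem IsMetric.eq_zero_of_sylvester {h : LinearMap.BilinForm ℝ V} (hh : IsMetric h)
    {l l' C : V →ₗ[ℝ] V} (hl : ∀ v, v ≠ 0 → 0 < h (l v) v)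
    (hs' : ∀ v w, h (l' v) w = h v (l' w)) (hl' : ∀ v, v ≠ 0 → 0 < h (l' v) v)
    (hC : ∀ v, l (C v) + C (l' v) = 0) : C = 0 := by
  obtain ⟨c, μ, -, h2⟩ := hh.exists_diagonalization l' hs'
  -- On an eigenvector `e` of `l'` with eigenvalue `μ i > 0` the equation reads `l (C e) = -μ i • C
  -- e`, which contradicts the positivity of `l` unless `C e = 0`.
  have hb : C ∘ₗ c.symm.toLinearMap = 0 := by
    refine LinearMap.pi_ext' fun i => LinearMap.ext_ring ?_
    simp only [LinearMap.comp_apply, LinearEquiv.coe_coe, LinearMap.zero_apply]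
    set e := c.symm (LinearMap.single ℝ (fun _ => ℝ) i 1) with he
    have hce : c e = Pi.single i 1 := by simp [he]
    have he0 : e ≠ 0 := by
      intro h0
      rw [h0, map_zero] at hce
      simpa using congrFun hce i
    have hle : l' e = μ i • e := by
      apply c.injective
      ext j
      rw [h2, map_smul, hce]
      rcases eq_or_ne j i with rfl | hj
      · simp
      · simp [hj]
    have hμ : 0 < μ i := by
      have := hl' e he0
      rw [hle, map_smul, LinearMap.smul_apply, smul_eq_mul] at this
      exact pos_of_mul_pos_left this (hh.pos e he0).le
    by_contra hne
    have h3 : l (C e) = -(μ i • C e) := by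
      have := hC e
      rw [hle, map_smul] at this
      exact eq_neg_of_add_eq_zero_left this
    have h4 := hl (C e) hne
    rw [h3, map_neg, map_smul, LinearMap.neg_apply, LinearMap.smul_apply, smul_eq_mul] at h4
    have := mul_pos hμ (hh.pos _ hne)
    linarith
  ext v
  simpa using LinearMap.congr_fun hb (c v)

/-- `l` is the positive self-adjoint operator with `h' = h (l ·) (l ·)`. -/
structure IsTransport (h h' : LinearMap.BilinForm ℝ V) (l : V →ₗ[ℝ] V) : Prop where
  selfAdj : ∀ v w, h (l v) w = h v (l w)
  pos : ∀ v, v ≠ 0 → 0 < h (l v) v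
  map : ∀ v w, h (l v) (l w) = h' v w

/-- The operator `T` with `h (T ·) · = h'` is self-adjoint with positive eigenvalues; `l` is its
square root, taken eigenvalue by eigenvalue. -/
theorem exists_isTransport {h h' : LinearMap.BilinForm ℝ V} (hh : IsMetric h)
    (hh' : IsMetric h') : ∃ l, IsTransport h h' l := by
  have hTd := h'.symmCompOfNondegenerate_left_apply hh.nondegenerate
  set T := h'.symmCompOfNondegenerate h hh.nondegenerate
  have hT : ∀ v w, h (T v) w = h v (T w) := fun v w => by
    rw [hTd, hh.symm v, hTd, hh'.symm]
  obtain ⟨c, μ, h1, h2⟩ := hh.exists_diagonalization T hT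
  have hμ : ∀ i, 0 < μ i := fun i => by
    have he : c.symm (Pi.single i 1) ≠ 0 := by
      rw [Ne, LinearEquiv.map_eq_zero_iff]
      intro h0
      simpa using congrFun h0 i
    have := hh'.pos _ he
    rw [← hTd, h1] at this
    simp only [h2, LinearEquiv.apply_symm_apply] at this
    rw [Finset.sum_eq_single i (by intro j _ hj; simp [hj]) (by simp)] at this
    simpa using this
  let D : (Fin (Module.finrank ℝ V) → ℝ) →ₗ[ℝ] (Fin (Module.finrank ℝ V) → ℝ) :=
    LinearMap.pi fun i => √(μ i) • LinearMap.proj i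
  have hl : ∀ v i, c ((c.symm.toLinearMap ∘ₗ D ∘ₗ c.toLinearMap) v) i = √(μ i) * c v i := by
    intro v i
    simp [D]
  refine ⟨c.symm.toLinearMap ∘ₗ D ∘ₗ c.toLinearMap, fun v w => ?_, fun v hv => ?_, fun v w => ?_⟩
  · rw [h1, h1]
    refine Finset.sum_congr rfl fun i _ => ?_
    rw [hl, hl]
    ring
  · rw [h1]
    have hc : c v ≠ 0 := by simpa using hv
    obtain ⟨i, hi⟩ := Function.ne_iff.1 hc
    refine Finset.sum_pos' (fun j _ => ?_) ⟨i, Finset.mem_univ i, ?_⟩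
    · rw [hl, mul_assoc]
      exact mul_nonneg (Real.sqrt_nonneg _) (mul_self_nonneg _)
    · rw [hl, mul_assoc]
      exact mul_pos (Real.sqrt_pos.2 (hμ i)) (mul_self_pos.2 hi)
  · rw [h1, ← hTd, h1]
    refine Finset.sum_congr rfl fun i _ => ?_
    rw [hl, hl, h2]
    linear_combination (c v i * c w i) * Real.mul_self_sqrt (hμ i).le

omit [FiniteDimensional ℝ V] in
theorem IsTransport.sq {h h' : LinearMap.BilinForm ℝ V} {l : V →ₗ[ℝ] V}
    (hl : IsTransport h h' l) (v w : V) : h (l (l v)) w = h' v w := by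
  rw [hl.selfAdj, hl.map]

/-- Both squares represent `h'`, so `l² = l'²`, and then `C = l - l'` solves the Sylvester equation
`l C + C l' = l² - l'² = 0`. -/
theorem IsTransport.unique {h h' : LinearMap.BilinForm ℝ V} (hh : IsMetric h)
    {l l' : V →ₗ[ℝ] V} (hl : IsTransport h h' l) (hl' : IsTransport h h' l') : l = l' := by
  rw [← sub_eq_zero]
  refine hh.eq_zero_of_sylvester hl.pos hl'.selfAdj hl'.pos fun v => ?_
  have : l (l v) = l' (l' v) := hh.eq_of_forall fun u => by rw [hl.sq, hl'.sq]
  simp [this]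

/-- The transport operator commutes with all operators which are symmetric for both forms. -/
theorem IsTransport.commute {h h' : LinearMap.BilinForm ℝ V} (hh : IsMetric h)
    {l R : V →ₗ[ℝ] V} (hl : IsTransport h h' l) (hR : ∀ v w, h (R v) w = h v (R w))
    (hR' : ∀ v w, h' (R v) w = h' v (R w)) (v : V) : l (R v) = R (l v) := by
  have hsq : ∀ v, l (l (R v)) = R (l (l v)) := fun v => hh.eq_of_forall fun u => by
    rw [hl.sq, hR', hR, hl.sq]
  -- For the commutator, `l C + C l = l² R - R l²`, which vanishes because `R` commutes with `l²`.
  have hC := hh.eq_zero_of_sylvester (C := l ∘ₗ R - R ∘ₗ l) hl.pos hl.selfAdj hl.pos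
    fun v => by simp [hsq]
  simpa [sub_eq_zero] using LinearMap.congr_fun hC v

omit [FiniteDimensional ℝ V] in
theorem IsTransport.injective {h h' : LinearMap.BilinForm ℝ V} {l : V →ₗ[ℝ] V}
    (hl : IsTransport h h' l) : Function.Injective l := by
  rw [injective_iff_map_eq_zero]
  intro v hv
  by_contra hne
  have := hl.pos v hne
  simp [hv] at this

/-- The form `b ((2 P - 1) ·, ·)`. -/
def polar (b : LinearMap.BilinForm ℝ V) (P : V →ₗ[ℝ] V) : LinearMap.BilinForm ℝ V :=
  b ∘ₗ ((2 : ℝ) • P - LinearMap.id)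

omit [FiniteDimensional ℝ V] in
theorem polar_apply (b : LinearMap.BilinForm ℝ V) (P : V →ₗ[ℝ] V) (v w : V) :
    polar b P v w = 2 * b (P v) w - b v w := by
  simp [polar]

/-- `P` is a `b`-orthogonal projection whose range and kernel are positive and negative definite
subspaces for `b`. -/
structure IsPolarization (b : LinearMap.BilinForm ℝ V) (P : V →ₗ[ℝ] V) : Prop where
  idem : ∀ v, P (P v) = P v
  selfAdj : ∀ v w, b (P v) w = b v (P w)
  metric : IsMetric (polar b P)

omit [FiniteDimensional ℝ V] in
theorem IsPolarization.polar_selfAdj {b : LinearMap.BilinForm ℝ V} {P : V →ₗ[ℝ] V}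
    (hP : IsPolarization b P) (v w : V) : polar b P (P v) w = polar b P v (P w) := by
  rw [polar_apply, polar_apply, hP.idem, hP.selfAdj v w, hP.selfAdj v (P w), hP.idem]

/-- The projection `P` is self-adjoint for both polar metrics, so `l` commutes with it. As `(2P -
1)² = 1`, each form is recovered from its metric by inserting `2P - 1` once more, and `l` respects
this recipe. -/
theorem IsPolarization.map_transport {b b' : LinearMap.BilinForm ℝ V} {P l : V →ₗ[ℝ] V}
    (hP : IsPolarization b P) (hP' : IsPolarization b' P)
    (hl : IsTransport (polar b P) (polar b' P) l) (v w : V) : b (l v) (l w) = b' v w := by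
  have hc := hl.commute hP.metric hP.polar_selfAdj hP'.polar_selfAdj
  -- This is `1 = (2P - 1)² + 4(P - P²)`; the last term drops out by idempotence.
  have key : ∀ (c : LinearMap.BilinForm ℝ V), ∀ v w,
      c v w = 2 * (2 * c (P (P v)) w - c (P v) w) - (2 * c (P v) w - c v w) +
        4 * (c (P v) w - c (P (P v)) w) := fun c v w => by ring
  rw [key b, key b', hP.idem, hP.idem, sub_self, sub_self]
  have h1 := hl.map (P v) w
  have h2 := hl.map v w
  rw [polar_apply, polar_apply, hc, hP.idem, hP.idem] at h1
  rw [polar_apply, polar_apply] at h2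
  linarith

/-- The positive spectral projection of the operator representing `b` with respect to `h`. -/
theorem isPolarization_of_isTransport {h b : LinearMap.BilinForm ℝ V} (hh : IsMetric h)
    (hb : ∀ v w, b v w = b w v) {A l l' : V →ₗ[ℝ] V}
    (hA : ∀ v w, h (A v) w = b v w) (hl : IsTransport h (h.compl₁₂ A A) l)
    (hll' : ∀ v, l (l' v) = v) :
    IsPolarization b ((1 / 2 : ℝ) • (LinearMap.id + A ∘ₗ l')) := by
  have hAs : ∀ v w, h (A v) w = h v (A w) := fun v w => by rw [hA, hh.symm v, hA, hb]
  -- So `l = |A|`, and below `A ∘ l'` is the sign of `A`: an involution with `b (A (l' ·)) · = h (l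
  -- ·) ·`. The polar form is therefore the metric `h (l ·) ·`.
  have hsq : ∀ v, A (A v) = l (l v) := fun v => hh.eq_of_forall fun u => by
    rw [hl.sq, LinearMap.compl₁₂_apply, hAs]
  have hc := hl.commute hh (R := A) hAs fun v w => by
    rw [LinearMap.compl₁₂_apply, LinearMap.compl₁₂_apply, hAs]
  have hAJ : ∀ v, A (A (l' v)) = l v := fun v => by rw [hsq, hll']
  have hJ : ∀ v, A (l' (A (l' v))) = v := fun v => by
    apply hl.injective
    rw [hc, hll', hAJ]
  have hbJ : ∀ v w, b (A (l' v)) w = h (l v) w := fun v w => by rw [← hA, hAJ]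
  have hpol : ∀ v w, polar b ((1 / 2 : ℝ) • (LinearMap.id + A ∘ₗ l')) v w = h (l v) w := by
    intro v w
    rw [polar_apply, ← hbJ]
    simp
    ring
  refine ⟨fun v => ?_, fun v w => ?_, fun v w => ?_, fun v hv => ?_⟩
  · simp only [LinearMap.smul_apply, LinearMap.add_apply, LinearMap.id_apply, LinearMap.comp_apply,
      map_smul, map_add, hJ]
    module
  · have : b (A (l' v)) w = b v (A (l' w)) := by
      rw [hbJ, hb v, hbJ, hl.selfAdj, hh.symm]
    simp [this]
  · rw [hpol, hpol, hl.selfAdj, hh.symm]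
  · rw [hpol]
    exact hl.pos v hv

end Algebra

/-! ### Continuity of inverses and of transport operators on a fixed space -/

section Local

variable {X : Type*} [TopologicalSpace X] {A B : Type*}
  [NormedAddCommGroup A] [NormedSpace ℝ A] [FiniteDimensional ℝ A]
  [NormedAddCommGroup B] [NormedSpace ℝ B]

/-- A shortcut instance: the general search is slow here. -/
local instance : SeminormedAddCommGroup (A →L[ℝ] A →L[ℝ] ℝ) :=
  ContinuousLinearMap.toSeminormedAddCommGroup

/-- A shortcut instance: the general search is slow here. -/
local instance : NormedAddCommGroup (A →L[ℝ] A →L[ℝ] ℝ) :=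
  ContinuousLinearMap.toNormedAddCommGroup

/-- Pointwise inverses of a continuous family of operators form a continuous family. -/
theorem continuousAt_of_inverse {f : X → A →L[ℝ] B} {g : X → B →L[ℝ] A} {x₀ : X}
    (hf : ContinuousAt f x₀) (h₁ : ∀ᶠ x in 𝓝 x₀, ∀ a, g x (f x a) = a)
    (h₂ : ∀ᶠ x in 𝓝 x₀, ∀ b, f x (g x b) = b) : ContinuousAt g x₀ := by
  have : CompleteSpace A := FiniteDimensional.complete ℝ A
  let e : A ≃L[ℝ] B := ContinuousLinearEquiv.equivOfInverse (f x₀) (g x₀)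
    h₁.self_of_nhds h₂.self_of_nhds
  have he : ContinuousAt ContinuousLinearMap.inverse (f x₀) :=
    (contDiffAt_map_inverse (n := 0) e).continuousAt
  refine (ContinuousAt.comp (f := f) he hf).congr ?_
  filter_upwards [h₁, h₂] with x hx₁ hx₂
  exact ContinuousLinearMap.inverse_equiv
    (ContinuousLinearEquiv.equivOfInverse (f x) (g x) hx₁ hx₂)

omit [TopologicalSpace X] [FiniteDimensional ℝ A] in
theorem tendsto_clm_apply {u : Filter X} {f : X → A →L[ℝ] B} {f₀ : A →L[ℝ] B} {a : X → A} {a₀ : A}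
    (hf : Tendsto f u (𝓝 f₀)) (ha : Tendsto a u (𝓝 a₀)) :
    Tendsto (fun x => f x (a x)) u (𝓝 (f₀ a₀)) :=
  (isBoundedBilinearMap_apply (𝕜 := ℝ) (E := A) (F := B)).continuous.tendsto (f₀, a₀) |>.comp
    (hf.prodMk_nhds ha)

/-- The bilinear form underlying a continuous bilinear form. -/
def toBilin (h : A →L[ℝ] A →L[ℝ] ℝ) : LinearMap.BilinForm ℝ A :=
  (ContinuousLinearMap.coeLM ℝ) ∘ₗ h.toLinearMap

omit [FiniteDimensional ℝ A] in
theorem toBilin_apply (h : A →L[ℝ] A →L[ℝ] ℝ) (v w : A) : toBilin h v w = h v w := rfl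

/-- A metric on a finite-dimensional space dominates the norm, uniformly for nearby metrics. -/
theorem exists_pos_le_of_continuousAt {h : X → A →L[ℝ] A →L[ℝ] ℝ} {x₀ : X}
    (hc : ContinuousAt h x₀) (hm : IsMetric (toBilin (h x₀))) :
    ∃ c > 0, ∀ᶠ x in 𝓝 x₀, ∀ v, c * ‖v‖ ^ 2 ≤ h x v v := by
  have : ProperSpace A := FiniteDimensional.proper ℝ A
  -- Half of the minimum on the unit sphere: the other half absorbs the change from `h x₀` to `h x`.
  -- If `A` is zero, the sphere is empty and any constant works.
  obtain ⟨c, hc0, hc1⟩ : ∃ c > 0, ∀ v ∈ Metric.sphere (0 : A) 1, 2 * c ≤ h x₀ v v := by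
    rcases (Metric.sphere (0 : A) 1).eq_empty_or_nonempty with he | hne
    · exact ⟨1, one_pos, by simp [he]⟩
    · obtain ⟨v, hv, hmin⟩ := (isCompact_sphere (0 : A) 1).exists_isMinOn hne
        (f := fun v => h x₀ v v) (by fun_prop)
      have hv0 : v ≠ 0 := by
        rintro rfl
        simp at hv
      refine ⟨h x₀ v v / 2, half_pos (hm.pos v hv0), fun w hw => ?_⟩
      have := hmin hw
      simp only [Set.mem_ofPred_eq] at this
      linarith
  refine ⟨c, hc0, ?_⟩
  filter_upwards [Metric.tendsto_nhds.1 hc c hc0] with x hx v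
  rw [dist_eq_norm] at hx
  rcases eq_or_ne v 0 with rfl | hv
  · simp
  have hn : 0 < ‖v‖ := norm_pos_iff.2 hv
  have h1 : 2 * c * ‖v‖ ^ 2 ≤ h x₀ v v := by
    have := hc1 (‖v‖⁻¹ • v) (by simp [norm_smul, hn.ne'])
    simp only [map_smul, smul_apply, smul_eq_mul] at this
    calc 2 * c * ‖v‖ ^ 2 ≤ (‖v‖⁻¹ * (‖v‖⁻¹ * h x₀ v v)) * ‖v‖ ^ 2 := by gcongr
      _ = h x₀ v v := by field_simp
  have h2 : |h x v v - h x₀ v v| ≤ c * ‖v‖ ^ 2 := by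
    calc |h x v v - h x₀ v v| = ‖(h x - h x₀) v v‖ := by simp
      _ ≤ ‖h x - h x₀‖ * ‖v‖ * ‖v‖ := ContinuousLinearMap.le_opNorm₂ _ _ _
      _ ≤ c * ‖v‖ * ‖v‖ := by gcongr
      _ = c * ‖v‖ ^ 2 := by ring
  have := neg_abs_le (h x v v - h x₀ v v)
  linarith

/-- The transport operator depends continuously on the two metrics. -/
theorem continuousAt_of_isTransport {h h' : X → A →L[ℝ] A →L[ℝ] ℝ} {l : X → A →L[ℝ] A} {x₀ : X}
    (hc : ContinuousAt h x₀) (hc' : ContinuousAt h' x₀) (hm : IsMetric (toBilin (h x₀)))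
    (hm' : IsMetric (toBilin (h' x₀)))
    (hl : ∀ᶠ x in 𝓝 x₀, IsTransport (toBilin (h x)) (toBilin (h' x)) (l x).toLinearMap) :
    ContinuousAt l x₀ := by
  obtain ⟨c, hc0, hlow⟩ := exists_pos_le_of_continuousAt hc hm
  set M := ‖h' x₀‖ + 1 with hM
  have hup : ∀ᶠ x in 𝓝 x₀, ‖h' x‖ < M :=
    hc'.norm.eventually (gt_mem_nhds (lt_add_one _))
  have hM0 : 0 ≤ M := by positivity
  -- The radius comes from `c ‖l v‖² ≤ h (l v) (l v) = h' v v ≤ M ‖v‖²`.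
  have hbd : ∀ᶠ x in 𝓝 x₀, l x ∈ Metric.closedBall (0 : A →L[ℝ] A) √(M / c) := by
    filter_upwards [hlow, hup, hl] with x h1 h2 h3
    rw [mem_closedBall_zero_iff]
    refine ContinuousLinearMap.opNorm_le_bound _ (Real.sqrt_nonneg _) fun v => ?_
    refine abs_le_of_sq_le_sq' ?_ (by positivity) |>.2
    rw [mul_pow, Real.sq_sqrt (by positivity), div_mul_eq_mul_div, le_div_iff₀ hc0, mul_comm]
    calc c * ‖l x v‖ ^ 2 ≤ h x (l x v) (l x v) := h1 _
      _ = h' x v v := h3.map v v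
      _ ≤ ‖h' x v v‖ := le_abs_self _
      _ ≤ ‖h' x‖ * ‖v‖ * ‖v‖ := ContinuousLinearMap.le_opNorm₂ _ _ _
      _ ≤ M * ‖v‖ * ‖v‖ := by gcongr
      _ = M * ‖v‖ ^ 2 := by ring
  have : ProperSpace (A →L[ℝ] A) := FiniteDimensional.proper ℝ _
  -- By compactness it is enough that every cluster point `k` equals `l x₀`; by uniqueness it is
  -- enough that `k` is a transport operator at `x₀`.
  refine (isCompact_closedBall (0 : A →L[ℝ] A) √(M / c)).tendsto_nhds_of_unique_mapClusterPt
    hbd fun k _ hk => ?_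
  obtain ⟨U, hU, hkU⟩ := mapClusterPt_iff_ultrafilter.1 hk
  have hhU : Tendsto h U (𝓝 (h x₀)) := hc.mono_left hU
  have hhU' : Tendsto h' U (𝓝 (h' x₀)) := hc'.mono_left hU
  have hlU : ∀ᶠ x in (U : Filter X),
      IsTransport (toBilin (h x)) (toBilin (h' x)) (l x).toLinearMap := hU hl
  have hev : ∀ {H : X → A →L[ℝ] A →L[ℝ] ℝ} {H₀}, Tendsto H U (𝓝 H₀) → ∀ {a b : X → A} {a₀ b₀},
      Tendsto a U (𝓝 a₀) → Tendsto b U (𝓝 b₀) →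
        Tendsto (fun x => H x (a x) (b x)) U (𝓝 (H₀ a₀ b₀)) :=
    fun hH _ _ _ _ ha hb => tendsto_clm_apply (tendsto_clm_apply hH ha) hb
  have hkv : ∀ v, Tendsto (fun x => l x v) U (𝓝 (k v)) :=
    fun v => tendsto_clm_apply hkU tendsto_const_nhds
  have hadj : ∀ v w, h x₀ (k v) w = h x₀ v (k w) := fun v w =>
    tendsto_nhds_unique_of_eventuallyEq (hev hhU (hkv v) tendsto_const_nhds)
      (hev hhU tendsto_const_nhds (hkv w)) (hlU.mono fun x hx => hx.selfAdj v w)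
  have hmap : ∀ v w, h x₀ (k v) (k w) = h' x₀ v w := fun v w =>
    tendsto_nhds_unique_of_eventuallyEq (hev hhU (hkv v) (hkv w))
      (hev hhU' tendsto_const_nhds tendsto_const_nhds) (hlU.mono fun x hx => hx.map v w)
  have hnonneg : ∀ v, 0 ≤ h x₀ (k v) v := fun v => by
    refine ge_of_tendsto (hev hhU (hkv v) tendsto_const_nhds) (hlU.mono fun x hx => ?_)
    rcases eq_or_ne v 0 with rfl | hv
    · simp
    · exact (hx.pos v hv).le
  -- Only strict positivity can be lost in the limit. For the semidefinite form `h (k ·) ·`, a null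
  -- vector `v` satisfies `h (k v) w = 0` for all `w`; then `h' v v = h (k v) (k v) = 0`, so `v =
  -- 0`.
  have hkt : IsTransport (toBilin (h x₀)) (toBilin (h' x₀)) k.toLinearMap := by
    refine ⟨hadj, fun v hv => lt_of_le_of_ne (hnonneg v) fun h0 => ?_, hmap⟩
    have h0' : h x₀ (k v) v = 0 := h0.symm
    have hlin : ∀ w, h x₀ (k v) w = 0 := fun w => by
      by_contra hne
      set a := h x₀ (k v) w with ha
      have hsym : h x₀ (k w) v = a := by rw [hadj]; exact hm.symm _ _
      set d := h x₀ (k w) w with hd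
      have hpoly : ∀ t : ℝ, 0 ≤ 2 * t * a + t ^ 2 * d := fun t => by
        have := hnonneg (v + t • w)
        simp only [map_add, map_smul, add_apply,
          smul_apply, smul_eq_mul, h0', hsym, ← ha, ← hd] at this
        nlinarith
      have hd0 : 0 ≤ d := hnonneg w
      -- The minimum of the quadratic is near `t = -a / d`; the shift to `d + 1` covers the case `d
      -- = 0`.
      have := hpoly (-a / (d + 1))
      have h5 : 2 * (-a / (d + 1)) * a + (-a / (d + 1)) ^ 2 * d =
          -(a ^ 2 * (d + 2) / (d + 1) ^ 2) := by
        field_simp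
        ring
      rw [h5] at this
      have : 0 < a ^ 2 * (d + 2) / (d + 1) ^ 2 := by positivity
      linarith
    have := hm'.pos v hv
    rw [toBilin_apply, ← hmap, hlin] at this
    exact lt_irrefl _ this
  have := hkt.unique hm hl.self_of_nhds
  exact ContinuousLinearMap.coe_injective this

end Local

/-! ### Continuity of representing operators -/

section Represent

variable {X : Type*} [TopologicalSpace X] {A : Type*}
  [NormedAddCommGroup A] [NormedSpace ℝ A] [FiniteDimensional ℝ A]

/-- The operators representing a continuous family of forms with respect to a continuous family of
metrics form a continuous family. -/
theorem continuousAt_of_represents {h b : X → A →L[ℝ] A →L[ℝ] ℝ} {T : X → A →L[ℝ] A} {x₀ : X}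
    (hh : ContinuousAt h x₀) (hb : ContinuousAt b x₀)
    (hm : ∀ᶠ x in 𝓝 x₀, IsMetric (toBilin (h x)))
    (hT : ∀ᶠ x in 𝓝 x₀, ∀ v w, h x (T x v) w = b x v w) : ContinuousAt T x₀ := by
  have : CompleteSpace A := FiniteDimensional.complete ℝ A
  -- A metric is an isomorphism of `A` with its dual, so `T x = (h x)⁻¹ ∘ b x`, and inversion is
  -- continuous at isomorphisms.
  have key : ∀ x, IsMetric (toBilin (h x)) → ∃ e : A ≃L[ℝ] (A →L[ℝ] ℝ), h x = e := fun x hx => by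
    have hinj : Function.Injective (h x).toLinearMap := fun v w hvw =>
      hx.eq_of_forall fun u => congrArg (fun φ : A →L[ℝ] ℝ => φ u) hvw
    have hd : Module.finrank ℝ A = Module.finrank ℝ (A →L[ℝ] ℝ) := by
      rw [← (LinearMap.toContinuousLinearMap (𝕜 := ℝ) (E := A) (F' := ℝ)).finrank_eq]
      exact Subspace.dual_finrank_eq.symm
    exact ⟨(LinearEquiv.ofInjectiveOfFinrankEq _ hinj hd).toContinuousLinearEquiv, rfl⟩
  obtain ⟨e, he⟩ := key x₀ hm.self_of_nhds
  have hinv : ContinuousAt ContinuousLinearMap.inverse (h x₀) := by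
    rw [he]
    exact (contDiffAt_map_inverse (n := 0) e).continuousAt
  refine ((ContinuousAt.comp (f := h) hinv hh).clm_comp hb).congr ?_
  filter_upwards [hm, hT] with x hx hxT
  obtain ⟨e, he⟩ := key x hx
  ext v
  have : b x v = h x (T x v) := by
    ext w
    exact (hxT v w).symm
  simp [this, he]

end Represent

/-! ### Continuity on the total space, read in local trivializations -/

section Coordinates

set_option linter.unusedSectionVars false

variable {X : Type*} [TopologicalSpace X]
  {F : Type*} [NormedAddCommGroup F] [NormedSpace ℝ F]
  {E : X → Type*} [TopologicalSpace (TotalSpace F E)]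
  [∀ x, AddCommGroup (E x)] [∀ x, Module ℝ (E x)]

section Mk

variable {Z : Type*} [TopologicalSpace Z] {ξ : Z → X} {v w : ∀ z, E (ξ z)} {z₀ : Z}

/-- Continuity into the total space, read in a linear local trivialization. -/
theorem continuousAt_mk_iff (e : Trivialization F (π F E)) [e.IsLinear ℝ] (hz : ξ z₀ ∈ e.baseSet) :
    ContinuousAt (fun z => (⟨ξ z, v z⟩ : TotalSpace F E)) z₀ ↔
      ContinuousAt ξ z₀ ∧ ContinuousAt (fun z => e.linearMapAt ℝ (ξ z) (v z)) z₀ := by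
  rw [ContinuousAt, e.tendsto_nhds_iff (e.mem_source.2 hz)]
  refine and_congr_right fun hξ => ?_
  have hev : ∀ᶠ z in 𝓝 z₀, ξ z ∈ e.baseSet := hξ (e.open_baseSet.mem_nhds hz)
  rw [ContinuousAt, e.coe_linearMapAt_of_mem hz]
  refine tendsto_congr' (hev.mono fun z hz => ?_)
  simp only [e.coe_linearMapAt_of_mem hz]

theorem continuousAt_mk_symmₗ (e : Trivialization F (π F E)) [e.IsLinear ℝ] {a : Z → F}
    (hz : ξ z₀ ∈ e.baseSet) (hξ : ContinuousAt ξ z₀) (ha : ContinuousAt a z₀) :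
    ContinuousAt (fun z => (⟨ξ z, e.symmₗ ℝ (ξ z) (a z)⟩ : TotalSpace F E)) z₀ := by
  refine (continuousAt_mk_iff e hz).2 ⟨hξ, ha.congr ?_⟩
  filter_upwards [hξ (e.open_baseSet.mem_nhds hz)] with z hz
  exact (e.linearMapAt_symmₗ hz _).symm

theorem continuous_mk_of_forall (hξ : Continuous ξ)
    (h : ∀ z₀, ∃ e : Trivialization F (π F E), ∃ _ : e.IsLinear ℝ, ξ z₀ ∈ e.baseSet ∧
      ContinuousAt (fun z => e.linearMapAt ℝ (ξ z) (v z)) z₀) :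
    Continuous (fun z => (⟨ξ z, v z⟩ : TotalSpace F E)) :=
  continuous_iff_continuousAt.2 fun z₀ => by
    obtain ⟨e, he, hz, hc⟩ := h z₀
    exact (continuousAt_mk_iff e hz).2 ⟨hξ.continuousAt, hc⟩

variable [∀ x, TopologicalSpace (E x)] [FiberBundle F E] [VectorBundle ℝ F E]

theorem continuousAt_mk_add (hv : ContinuousAt (fun z => (⟨ξ z, v z⟩ : TotalSpace F E)) z₀)
    (hw : ContinuousAt (fun z => (⟨ξ z, w z⟩ : TotalSpace F E)) z₀) :
    ContinuousAt (fun z => (⟨ξ z, v z + w z⟩ : TotalSpace F E)) z₀ := by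
  have hz := FiberBundle.mem_baseSet_trivializationAt F E (ξ z₀)
  rw [continuousAt_mk_iff _ hz] at hv hw ⊢
  simp only [map_add]
  exact ⟨hv.1, hv.2.add hw.2⟩

theorem continuousAt_mk_smul {c : Z → ℝ} (hc : ContinuousAt c z₀)
    (hv : ContinuousAt (fun z => (⟨ξ z, v z⟩ : TotalSpace F E)) z₀) :
    ContinuousAt (fun z => (⟨ξ z, c z • v z⟩ : TotalSpace F E)) z₀ := by
  have hz := FiberBundle.mem_baseSet_trivializationAt F E (ξ z₀)
  rw [continuousAt_mk_iff _ hz] at hv ⊢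
  simp only [map_smul]
  exact ⟨hv.1, hc.smul hv.2⟩

theorem continuousAt_mk_sum {ι : Type*} (s : Finset ι) {u : ι → ∀ z, E (ξ z)}
    (hξ : ContinuousAt ξ z₀)
    (hu : ∀ i ∈ s, ContinuousAt (fun z => (⟨ξ z, u i z⟩ : TotalSpace F E)) z₀) :
    ContinuousAt (fun z => (⟨ξ z, ∑ i ∈ s, u i z⟩ : TotalSpace F E)) z₀ := by
  have hz := FiberBundle.mem_baseSet_trivializationAt F E (ξ z₀)
  rw [continuousAt_mk_iff _ hz]
  simp only [map_sum]
  exact ⟨hξ, tendsto_finsetSum _ fun i hi => ((continuousAt_mk_iff _ hz).1 (hu i hi)).2⟩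

end Mk

variable [FiniteDimensional ℝ F]

/-- A fibrewise endomorphism of `E` in a local trivialization. -/
def coordEnd (e : Trivialization F (π F E)) [e.IsLinear ℝ] (f : ∀ x, E x →ₗ[ℝ] E x) (x : X) :
    F →L[ℝ] F :=
  (e.linearMapAt ℝ x ∘ₗ f x ∘ₗ e.symmₗ ℝ x).toContinuousLinearMap

/-- A fibrewise bilinear form on `E` in a local trivialization. -/
def coordForm (e : Trivialization F (π F E)) [e.IsLinear ℝ]
    (b : ∀ x, LinearMap.BilinForm ℝ (E x)) (x : X) : F →L[ℝ] F →L[ℝ] ℝ :=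
  (LinearMap.toContinuousLinearMap.toLinearMap ∘ₗ
    (b x).compl₁₂ (e.symmₗ ℝ x) (e.symmₗ ℝ x)).toContinuousLinearMap

theorem coordEnd_apply (e : Trivialization F (π F E)) [e.IsLinear ℝ] (f : ∀ x, E x →ₗ[ℝ] E x)
    (x : X) (a : F) : coordEnd e f x a = e.linearMapAt ℝ x (f x (e.symmₗ ℝ x a)) := rfl

theorem coordForm_apply (e : Trivialization F (π F E)) [e.IsLinear ℝ]
    (b : ∀ x, LinearMap.BilinForm ℝ (E x)) (x : X) (a c : F) :
    coordForm e b x a c = b x (e.symmₗ ℝ x a) (e.symmₗ ℝ x c) := rfl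

theorem coordEnd_linearMapAt (e : Trivialization F (π F E)) [e.IsLinear ℝ]
    (f : ∀ x, E x →ₗ[ℝ] E x) {x : X} (hx : x ∈ e.baseSet) (v : E x) :
    coordEnd e f x (e.linearMapAt ℝ x v) = e.linearMapAt ℝ x (f x v) := by
  rw [coordEnd_apply, e.symmₗ_linearMapAt hx]

theorem isMetric_coordForm {e : Trivialization F (π F E)} [e.IsLinear ℝ]
    {b : ∀ x, LinearMap.BilinForm ℝ (E x)} {x : X} (hx : x ∈ e.baseSet) (hb : IsMetric (b x)) :
    IsMetric (toBilin (coordForm e b x)) where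
  symm _ _ := hb.symm _ _
  pos a ha := hb.pos _ fun h0 => ha <| by rw [← e.linearMapAt_symmₗ (R := ℝ) hx a, h0, map_zero]

theorem isTransport_coord {e : Trivialization F (π F E)} [e.IsLinear ℝ]
    {h h' : ∀ x, LinearMap.BilinForm ℝ (E x)} {l : ∀ x, E x →ₗ[ℝ] E x} {x : X}
    (hx : x ∈ e.baseSet) (hl : IsTransport (h x) (h' x) (l x)) :
    IsTransport (toBilin (coordForm e h x)) (toBilin (coordForm e h' x))
      (coordEnd e l x).toLinearMap := by
  refine ⟨fun v w => ?_, fun v hv => ?_, fun v w => ?_⟩ <;>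
  simp only [toBilin_apply, ContinuousLinearMap.coe_coe, coordForm_apply, coordEnd_apply,
    e.symmₗ_linearMapAt hx]
  · exact hl.selfAdj _ _
  · refine hl.pos _ fun h0 => hv ?_
    rw [← e.linearMapAt_symmₗ (R := ℝ) hx v, h0, map_zero]
  · exact hl.map _ _

variable (F) in
/-- The fibrewise endomorphism `f` is continuous on the total space. -/
def ContEnd (f : ∀ x, E x →ₗ[ℝ] E x) : Prop :=
  Continuous fun v : TotalSpace F E => (⟨v.proj, f v.proj v.snd⟩ : TotalSpace F E)

variable (F) in
/-- The fibrewise bilinear form `b` is symmetric, and its quadratic form is continuous on the total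
space. -/
structure ContForm (b : ∀ x, LinearMap.BilinForm ℝ (E x)) : Prop where
  symm : ∀ x v w, b x v w = b x w v
  cont : Continuous fun v : TotalSpace F E => b v.proj v.snd v.snd

theorem ContEnd.continuousAt_mk {f : ∀ x, E x →ₗ[ℝ] E x} (hf : ContEnd F f)
    {Z : Type*} [TopologicalSpace Z] {ξ : Z → X} {v : ∀ z, E (ξ z)} {z₀ : Z}
    (hv : ContinuousAt (fun z => (⟨ξ z, v z⟩ : TotalSpace F E)) z₀) :
    ContinuousAt (fun z => (⟨ξ z, f (ξ z) (v z)⟩ : TotalSpace F E)) z₀ :=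
  ContinuousAt.comp (f := fun z => (⟨ξ z, v z⟩ : TotalSpace F E)) (Continuous.continuousAt hf) hv

theorem ContEnd.continuousAt_coordEnd {f : ∀ x, E x →ₗ[ℝ] E x} (hf : ContEnd F f)
    (e : Trivialization F (π F E)) [e.IsLinear ℝ] {x₀ : X} (hx : x₀ ∈ e.baseSet) :
    ContinuousAt (coordEnd e f) x₀ :=
  continuousAt_clm_apply.2 fun a =>
    ((continuousAt_mk_iff e (ξ := id) hx).1
      (hf.continuousAt_mk (ξ := id) (v := fun x => e.symmₗ ℝ x a)
        (continuousAt_mk_symmₗ e (ξ := id) hx continuousAt_id continuousAt_const))).2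

variable [∀ x, TopologicalSpace (E x)] [FiberBundle F E] [VectorBundle ℝ F E]

theorem contEnd_of_continuousAt {f : ∀ x, E x →ₗ[ℝ] E x}
    (h : ∀ x₀, ∃ e : Trivialization F (π F E), ∃ _ : e.IsLinear ℝ, x₀ ∈ e.baseSet ∧
      ContinuousAt (coordEnd e f) x₀) : ContEnd F f := by
  refine continuous_mk_of_forall (FiberBundle.continuous_proj F E) fun v => ?_
  obtain ⟨e, he, hx, hc⟩ := h v.proj
  refine ⟨e, he, hx, ?_⟩
  have hp : ContinuousAt (TotalSpace.proj : TotalSpace F E → X) v :=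
    (FiberBundle.continuous_proj F E).continuousAt
  have h1 : ContinuousAt (fun w : TotalSpace F E => e.linearMapAt ℝ w.proj w.snd) v :=
    ((continuousAt_mk_iff e (ξ := TotalSpace.proj) (v := fun w : TotalSpace F E => w.snd) hx).1
      continuousAt_id).2
  refine (ContinuousAt.clm_apply (ContinuousAt.comp (f := TotalSpace.proj) hc hp) h1).congr ?_
  filter_upwards [hp (e.open_baseSet.mem_nhds hx)] with w hw
  exact coordEnd_linearMapAt e f hw _

theorem ContEnd.of_inverse {f g : ∀ x, E x →ₗ[ℝ] E x} (hf : ContEnd F f)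
    (h₁ : ∀ x v, g x (f x v) = v) (h₂ : ∀ x v, f x (g x v) = v) : ContEnd F g := by
  refine contEnd_of_continuousAt fun x₀ => ?_
  have hx := FiberBundle.mem_baseSet_trivializationAt F E x₀
  set e := trivializationAt F E x₀
  have hev := e.open_baseSet.mem_nhds hx
  refine ⟨e, inferInstance, hx, continuousAt_of_inverse (hf.continuousAt_coordEnd e hx) ?_ ?_⟩ <;>
  · filter_upwards [hev] with x hx a
    simp only [coordEnd_apply, e.symmₗ_linearMapAt hx, e.linearMapAt_symmₗ hx, h₁, h₂]

/-- Polarization identity: `2 b v w = b (v + w) (v + w) - b v v - b w w`, and addition in the fibres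
is continuous. -/
theorem ContForm.continuousAt_apply {b : ∀ x, LinearMap.BilinForm ℝ (E x)} (hb : ContForm F b)
    {Z : Type*} [TopologicalSpace Z] {ξ : Z → X} {v w : ∀ z, E (ξ z)} {z₀ : Z}
    (hv : ContinuousAt (fun z => (⟨ξ z, v z⟩ : TotalSpace F E)) z₀)
    (hw : ContinuousAt (fun z => (⟨ξ z, w z⟩ : TotalSpace F E)) z₀) :
    ContinuousAt (fun z => b (ξ z) (v z) (w z)) z₀ := by
  have hq : ∀ {u : ∀ z, E (ξ z)}, ContinuousAt (fun z => (⟨ξ z, u z⟩ : TotalSpace F E)) z₀ →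
      ContinuousAt (fun z => b (ξ z) (u z) (u z)) z₀ := fun {u} hu =>
    ContinuousAt.comp (f := fun z => (⟨ξ z, u z⟩ : TotalSpace F E)) hb.cont.continuousAt hu
  have := (((hq (continuousAt_mk_add hv hw)).sub (hq hv)).sub (hq hw)).div_const 2
  refine this.congr (Eventually.of_forall fun z => ?_)
  have hs := hb.symm _ (w z) (v z)
  simp only [Pi.sub_apply, map_add, LinearMap.add_apply]
  linarith

theorem ContForm.continuousAt_coordForm {b : ∀ x, LinearMap.BilinForm ℝ (E x)}
    (hb : ContForm F b) (e : Trivialization F (π F E)) [e.IsLinear ℝ] {x₀ : X}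
    (hx : x₀ ∈ e.baseSet) : ContinuousAt (coordForm e b) x₀ :=
  continuousAt_clm_apply.2 fun _ => continuousAt_clm_apply.2 fun _ =>
    hb.continuousAt_apply (ξ := id)
      (continuousAt_mk_symmₗ e (ξ := id) hx continuousAt_id continuousAt_const)
      (continuousAt_mk_symmₗ e (ξ := id) hx continuousAt_id continuousAt_const)

theorem contEnd_of_isTransport {h h' : ∀ x, LinearMap.BilinForm ℝ (E x)}
    {l : ∀ x, E x →ₗ[ℝ] E x} (hh : ContForm F h) (hh' : ContForm F h')
    (hm : ∀ x, IsMetric (h x)) (hm' : ∀ x, IsMetric (h' x))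
    (hl : ∀ x, IsTransport (h x) (h' x) (l x)) : ContEnd F l := by
  refine contEnd_of_continuousAt fun x₀ => ?_
  have hx := FiberBundle.mem_baseSet_trivializationAt F E x₀
  set e := trivializationAt F E x₀
  refine ⟨e, inferInstance, hx, continuousAt_of_isTransport (hh.continuousAt_coordForm e hx)
    (hh'.continuousAt_coordForm e hx) (isMetric_coordForm hx (hm _))
    (isMetric_coordForm hx (hm' _)) ?_⟩
  filter_upwards [e.open_baseSet.mem_nhds hx] with x hx
  exact isTransport_coord hx (hl x)

theorem contEnd_of_represents {h b : ∀ x, LinearMap.BilinForm ℝ (E x)}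
    {T : ∀ x, E x →ₗ[ℝ] E x} (hh : ContForm F h) (hb : ContForm F b)
    (hm : ∀ x, IsMetric (h x)) (hT : ∀ x v w, h x (T x v) w = b x v w) : ContEnd F T := by
  refine contEnd_of_continuousAt fun x₀ => ?_
  have hx := FiberBundle.mem_baseSet_trivializationAt F E x₀
  set e := trivializationAt F E x₀
  refine ⟨e, inferInstance, hx, continuousAt_of_represents (hh.continuousAt_coordForm e hx)
    (hb.continuousAt_coordForm e hx) ?_ ?_⟩
  · filter_upwards [e.open_baseSet.mem_nhds hx] with x hx
    exact isMetric_coordForm hx (hm x)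
  · filter_upwards [e.open_baseSet.mem_nhds hx] with x hx v w
    rw [coordForm_apply, coordEnd_apply, e.symmₗ_linearMapAt hx, hT, coordForm_apply]

theorem ContEnd.add {f g : ∀ x, E x →ₗ[ℝ] E x} (hf : ContEnd F f) (hg : ContEnd F g) :
    ContEnd F fun x => f x + g x :=
  continuous_iff_continuousAt.2 fun _ =>
    continuousAt_mk_add (Continuous.continuousAt hf) (Continuous.continuousAt hg)

theorem ContEnd.smul {f : ∀ x, E x →ₗ[ℝ] E x} (hf : ContEnd F f) (c : ℝ) :
    ContEnd F fun x => c • f x :=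
  continuous_iff_continuousAt.2 fun _ =>
    continuousAt_mk_smul continuousAt_const (Continuous.continuousAt hf)

theorem ContEnd.comp {f g : ∀ x, E x →ₗ[ℝ] E x} (hf : ContEnd F f) (hg : ContEnd F g) :
    ContEnd F fun x => f x ∘ₗ g x :=
  Continuous.comp hf hg

theorem contEnd_id : ContEnd F fun x => (LinearMap.id : E x →ₗ[ℝ] E x) :=
  continuous_id

theorem ContForm.pullback {b : ∀ x, LinearMap.BilinForm ℝ (E x)} (hb : ContForm F b)
    {f : ∀ x, E x →ₗ[ℝ] E x} (hf : ContEnd F f) :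
    ContForm F fun x => (b x).compl₁₂ (f x) (f x) where
  symm x _ _ := hb.symm x _ _
  cont := hb.cont.comp hf

theorem ContForm.polar {b : ∀ x, LinearMap.BilinForm ℝ (E x)} (hb : ContForm F b)
    {P : ∀ x, E x →ₗ[ℝ] E x} (hP : ContEnd F P) (hs : ∀ x, IsPolarization (b x) (P x)) :
    ContForm F fun x => polar (b x) (P x) where
  symm x := (hs x).metric.symm
  cont := by
    simp only [polar_apply]
    exact continuous_iff_continuousAt.2 fun _ =>
      ((hb.continuousAt_apply (Continuous.continuousAt hP) continuousAt_id).const_mul 2).sub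
        hb.cont.continuousAt

end Coordinates

/-! ### Existence of metrics -/

section Metric

set_option linter.unusedSectionVars false

variable {X : Type*} [TopologicalSpace X]
  (F : Type*) [NormedAddCommGroup F] [NormedSpace ℝ F] [FiniteDimensional ℝ F]
  (E : X → Type*) [TopologicalSpace (TotalSpace F E)]
  [∀ x, AddCommGroup (E x)] [∀ x, Module ℝ (E x)]
  [∀ x, TopologicalSpace (E x)] [FiberBundle F E] [VectorBundle ℝ F E]

variable {F E} in
/-- The form induced by a Euclidean inner product in a local trivialization. -/
def euclideanForm (e : Trivialization F (π F E)) [e.IsLinear ℝ] (x : X) :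
    LinearMap.BilinForm ℝ (E x) :=
  (innerₗ (EuclideanSpace ℝ (Fin (Module.finrank ℝ F)))).compl₁₂
    ((toEuclidean (E := F)).toLinearMap ∘ₗ e.linearMapAt ℝ x)
    ((toEuclidean (E := F)).toLinearMap ∘ₗ e.linearMapAt ℝ x)

theorem euclideanForm_apply (e : Trivialization F (π F E)) [e.IsLinear ℝ] (x : X) (v w : E x) :
    euclideanForm e x v w =
      inner ℝ (toEuclidean (e.linearMapAt ℝ x v)) (toEuclidean (e.linearMapAt ℝ x w)) := rfl

/-- Vector bundles over paracompact Hausdorff spaces carry metrics. -/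
theorem exists_metric [ParacompactSpace X] [T2Space X] :
    ∃ h : ∀ x, LinearMap.BilinForm ℝ (E x), ContForm F h ∧ ∀ x, IsMetric (h x) := by
  let e : X → Trivialization F (π F E) := trivializationAt F E
  have hmem : ∀ x, x ∈ (e x).baseSet := FiberBundle.mem_baseSet_trivializationAt F E
  obtain ⟨ρ, hρ⟩ := PartitionOfUnity.exists_isSubordinate isClosed_univ
    (fun i => (e i).baseSet) (fun i => (e i).open_baseSet)
    (fun x _ => Set.mem_iUnion.2 ⟨x, hmem x⟩)
  let B : ∀ _ : X, ∀ x, LinearMap.BilinForm ℝ (E x) := fun i x => euclideanForm (e i) x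
  have hBs : ∀ i x v w, B i x v w = B i x w v := fun i x v w => by
    simp only [B, euclideanForm_apply, real_inner_comm]
  have hBn : ∀ i x v, 0 ≤ B i x v v := fun i x v => by
    simp only [B, euclideanForm_apply]
    exact real_inner_self_nonneg
  have hBp : ∀ i x, x ∈ (e i).baseSet → ∀ v, v ≠ 0 → 0 < B i x v v := fun i x hx v hv => by
    simp only [B, euclideanForm_apply]
    refine real_inner_self_pos.2 fun h0 => hv ?_
    rw [EmbeddingLike.map_eq_zero_iff] at h0
    rw [← (e i).symmₗ_linearMapAt (R := ℝ) hx v, h0, map_zero]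
  have hρB : ∀ i, Continuous fun v : TotalSpace F E => ρ i v.proj * B i v.proj v.snd v.snd := by
    intro i
    have hπ := FiberBundle.continuous_proj F E
    refine continuous_iff_continuousAt.2 fun v => ?_
    -- The form `B i` need not be continuous outside the base set of `e i`, but there the factor `ρ
    -- i` vanishes in a neighbourhood.
    by_cases hv : v.proj ∈ tsupport (ρ i)
    · refine ((ρ i).continuous.comp hπ).continuousAt.mul ?_
      have h1 := ((continuousAt_mk_iff (e i) (ξ := TotalSpace.proj)
        (v := fun w : TotalSpace F E => w.snd) (hρ i hv)).1 continuousAt_id).2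
      have h2 := (toEuclidean (E := F)).continuous.continuousAt.comp h1
      exact h2.inner (𝕜 := ℝ) h2
    · refine continuousAt_const (y := (0 : ℝ)) |>.congr ?_
      filter_upwards [hπ.continuousAt ((isClosed_tsupport _).isOpen_compl.mem_nhds hv)] with w hw
      rw [image_eq_zero_of_notMem_tsupport hw, zero_mul]
  have happ : ∀ x v w, (∑ i ∈ ρ.finsupport x, ρ i x • B i x) v w =
      ∑ i ∈ ρ.finsupport x, ρ i x * B i x v w := fun x v w => by
    simp [LinearMap.sum_apply]
  refine ⟨fun x => ∑ i ∈ ρ.finsupport x, ρ i x • B i x, ⟨fun x v w => ?_, ?_⟩,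
    fun x => ⟨fun v w => ?_, fun v hv => ?_⟩⟩
  · simp only [happ, hBs]
  · refine continuous_iff_continuousAt.2 fun v => ?_
    -- The index set `ρ.finsupport x` moves with `x`; near a given point it lies in one finite set
    -- `I`, and the extra terms are zero.
    obtain ⟨I, hI⟩ := ρ.exists_finset_nhds v.proj
    have hc : Continuous fun v : TotalSpace F E =>
        ∑ i ∈ I, ρ i v.proj * B i v.proj v.snd v.snd := continuous_finsetSum _ fun i _ => hρB i
    refine hc.continuousAt.congr ?_
    filter_upwards [(FiberBundle.continuous_proj F E).continuousAt hI] with w hw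
    rw [happ]
    refine (Finset.sum_subset (fun i hi => hw.2 ((ρ.mem_finsupport _).1 hi)) fun i _ hi => ?_).symm
    rw [ρ.mem_finsupport, Function.notMem_support] at hi
    rw [hi, zero_mul]
  · simp only [happ, hBs]
  · rw [happ]
    have h1 : 0 < ∑ i ∈ ρ.finsupport x, ρ i x := by
      rw [ρ.sum_finsupport (Set.mem_univ x)]
      exact one_pos
    obtain ⟨i, hi, hi0⟩ := Finset.exists_lt_of_sum_lt (f := fun _ => (0 : ℝ)) (by simpa using h1)
    refine Finset.sum_pos' (fun j _ => mul_nonneg (ρ.nonneg j x) (hBn j x v)) ⟨i, hi, ?_⟩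
    exact mul_pos hi0 (hBp i x (hρ i (subset_tsupport _ hi0.ne')) v hv)

end Metric

/-! ### Splittings and continuous families of projections -/

section Projections

set_option linter.unusedSectionVars false

variable {X : Type*} [TopologicalSpace X]
  {F : Type*} [NormedAddCommGroup F] [NormedSpace ℝ F] [FiniteDimensional ℝ F]
  {E : X → Type*} [TopologicalSpace (TotalSpace F E)]
  [∀ x, AddCommGroup (E x)] [∀ x, Module ℝ (E x)]

/-- Composition of a local trivialization with a continuous family of automorphisms of the model
fibre. -/
def reparametrize (e : Trivialization F (π F E)) {U : Set X} (hU : IsOpen U) (hUe : U ⊆ e.baseSet)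
    {G G' : X → F →L[ℝ] F} (hG : ContinuousOn G U) (hG' : ContinuousOn G' U)
    (h₁ : ∀ x ∈ U, ∀ a, G x (G' x a) = a) (h₂ : ∀ x ∈ U, ∀ a, G' x (G x a) = a) :
    Trivialization F (π F E) where
  toFun v := (v.proj, G' v.proj (e v).2)
  invFun p := e.toOpenPartialHomeomorph.symm (p.1, G p.1 p.2)
  source := TotalSpace.proj ⁻¹' U
  target := U ×ˢ Set.univ
  map_source' v hv := ⟨hv, trivial⟩
  map_target' p hp := by
    rw [Set.mem_preimage, e.proj_symm_apply' (hUe hp.1)]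
    exact hp.1
  left_inv' v hv := by
    have hv' := hUe hv
    simp only [h₁ _ hv, e.symm_apply_mk_proj (e.mem_source.2 hv')]
  right_inv' p hp := by
    simp only [e.proj_symm_apply' (hUe hp.1), e.apply_symm_apply' (hUe hp.1), h₂ _ hp.1]
  open_source := by
    have : TotalSpace.proj ⁻¹' U = e.source ∩ (TotalSpace.proj ⁻¹' U) := by
      rw [e.source_eq]
      exact (Set.inter_eq_self_of_subset_right (Set.preimage_mono hUe)).symm
    rw [this]
    exact e.continuousOn_proj.isOpen_inter_preimage e.open_source hU
  open_target := hU.prod isOpen_univ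
  continuousOn_toFun := by
    have hs : TotalSpace.proj ⁻¹' U ⊆ e.source := e.preimage_subset_source hUe
    have hp : ContinuousOn TotalSpace.proj (TotalSpace.proj ⁻¹' U : Set (TotalSpace F E)) :=
      e.continuousOn_proj.mono hs
    exact hp.prodMk ((hG'.comp hp fun _ h => h).clm_apply
      (continuous_snd.comp_continuousOn (e.continuousOn.mono hs)))
  continuousOn_invFun := by
    refine e.toOpenPartialHomeomorph.continuousOn_symm.comp (continuousOn_fst.prodMk
      ((hG.comp continuousOn_fst fun _ h => h.1).clm_apply continuousOn_snd)) fun p hp => ?_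
    exact e.mem_target.2 (hUe hp.1)
  baseSet := U
  open_baseSet := hU
  source_eq := rfl
  target_eq := rfl
  proj_toFun _ _ := rfl

/-- A continuous family of projections is constant in suitable local trivializations. -/
theorem exists_trivialization_of_idempotent {P : ∀ x, E x →ₗ[ℝ] E x}
    [∀ x, TopologicalSpace (E x)] [FiberBundle F E] [VectorBundle ℝ F E]
    (hP : ContEnd F P) (hi : ∀ x v, P x (P x v) = P x v) (x₀ : X) :
    ∃ e : Trivialization F (π F E), ∃ _ : e.IsLinear ℝ, x₀ ∈ e.baseSet ∧ ∃ P₀ : F →ₗ[ℝ] F,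
      ∀ x ∈ e.baseSet, ∀ v, e.linearMapAt ℝ x (P x v) = P₀ (e.linearMapAt ℝ x v) := by
  have : CompleteSpace F := FiniteDimensional.complete ℝ F
  have hx₀ := FiberBundle.mem_baseSet_trivializationAt F E x₀
  set e := trivializationAt F E x₀
  set Q := coordEnd e P with hQdef
  have hQ : ContinuousOn Q e.baseSet := fun x hx =>
    (hP.continuousAt_coordEnd e hx).continuousWithinAt
  have hQi : ∀ x ∈ e.baseSet, Q x * Q x = Q x := fun x hx => by
    ext a
    simp only [mul_apply_eq_comp, hQdef, coordEnd_apply, e.symmₗ_linearMapAt hx, hi]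
  -- This operator satisfies `Q x * G x = G x * Q x₀` and is `1` at `x₀`, hence is invertible
  -- nearby. Composing `e` with its inverse turns `Q x` into the constant `Q x₀`.
  set G : X → F →L[ℝ] F := fun x => Q x * Q x₀ + (1 - Q x) * (1 - Q x₀) with hGdef
  have hGc : ContinuousOn G e.baseSet := by fun_prop
  have hG₀ : G x₀ = 1 := by
    simp only [hGdef, mul_sub, sub_mul, hQi x₀ hx₀]
    simp
  set U := e.baseSet ∩ G ⁻¹' {u | IsUnit u} with hUdef
  have hU : IsOpen U := hGc.isOpen_inter_preimage e.open_baseSet Units.isOpen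
  have hUx : x₀ ∈ U := ⟨hx₀, by simp [hG₀]⟩
  have hcomm : ∀ x ∈ e.baseSet, Q x * G x = G x * Q x₀ := fun x hx => by
    have h1 := hQi x hx
    have h2 := hQi x₀ hx₀
    have h3 : Q x * (1 - Q x) = 0 := by rw [mul_sub, mul_one, h1, sub_self]
    have h4 : (1 - Q x₀) * Q x₀ = 0 := by rw [sub_mul, one_mul, h2, sub_self]
    simp only [hGdef, mul_add, add_mul]
    rw [← mul_assoc, h1, ← mul_assoc, h3, zero_mul, mul_assoc (Q x), h2, mul_assoc, h4, mul_zero]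
  have hGi : ContinuousOn (fun x => Ring.inverse (G x)) U := fun x hx => by
    obtain ⟨u, hu⟩ := hx.2
    have := NormedRing.inverse_continuousAt u
    rw [hu] at this
    exact this.comp_continuousWithinAt ((hGc x hx.1).mono Set.inter_subset_left)
  have hm1 : ∀ x ∈ U, ∀ a, G x (Ring.inverse (G x) a) = a := fun x hx a => by
    rw [← mul_apply_eq_comp, Ring.mul_inverse_cancel _ hx.2]
    rfl
  have hm2 : ∀ x ∈ U, ∀ a, Ring.inverse (G x) (G x a) = a := fun x hx a => by
    rw [← mul_apply_eq_comp, Ring.inverse_mul_cancel _ hx.2]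
    rfl
  let e' := reparametrize e hU Set.inter_subset_left (hGc.mono Set.inter_subset_left) hGi hm1 hm2
  have he' : ∀ x (v : E x), (e' ⟨x, v⟩).2 = Ring.inverse (G x) (e ⟨x, v⟩).2 := fun _ _ => rfl
  have hlin : e'.IsLinear ℝ := ⟨fun x hx => by
    have hx' : x ∈ e.baseSet := hx.1
    have := ((Ring.inverse (G x)).toLinearMap ∘ₗ e.linearMapAt ℝ x).isLinear
    simp only [LinearMap.coe_comp, Function.comp_def, e.coe_linearMapAt_of_mem hx'] at this
    exact this⟩
  have hlm : ∀ x ∈ U, ∀ v : E x,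
      e'.linearMapAt ℝ x v = Ring.inverse (G x) (e.linearMapAt ℝ x v) := fun x hx v => by
    rw [e'.coe_linearMapAt_of_mem hx, e.coe_linearMapAt_of_mem hx.1]
    rfl
  refine ⟨e', hlin, hUx, (Q x₀).toLinearMap, fun x hx v => ?_⟩
  rw [hlm x hx, hlm x hx, ← coordEnd_linearMapAt e P hx.1]
  set a := e.linearMapAt ℝ x v
  have h1 : Q x a = G x (Q x₀ (Ring.inverse (G x) a)) := by
    conv_lhs => rw [← hm1 x hx a]
    rw [← mul_apply_eq_comp, hcomm x hx.1]
    rfl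
  exact (congrArg _ h1).trans (hm2 x hx _)

section

variable [∀ x, TopologicalSpace (E x)] [FiberBundle F E] [VectorBundle ℝ F E]

/-- The splitting of `E` into the images and the kernels of a continuous family of projections. -/
def Splitting.ofProjection (P : ∀ x, E x →ₗ[ℝ] E x) (hP : ContEnd F P)
    (hi : ∀ x v, P x (P x v) = P x v) : Splitting F E where
  -- The image of `P x` is written as a kernel, so that membership in either summand is a linear
  -- equation that can be read in a trivialization.
  fst x := LinearMap.ker (LinearMap.id - P x)
  snd x := LinearMap.ker (P x)
  isSubbundle_fst x₀ := by
    obtain ⟨e, he, hx, P₀, h⟩ := exists_trivialization_of_idempotent hP hi x₀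
    refine ⟨e, he, hx, LinearMap.ker (LinearMap.id - P₀), fun x hx v => ?_⟩
    have h1 : (e ⟨x, v⟩).2 = e.linearMapAt ℝ x v := by rw [e.coe_linearMapAt_of_mem hx]
    rw [h1]
    simp only [LinearMap.mem_ker, LinearMap.sub_apply, LinearMap.id_apply, ← h x hx, ← map_sub]
    rw [e.linearMapAt_def_of_mem hx]
    exact (LinearEquiv.map_eq_zero_iff _).symm
  isSubbundle_snd x₀ := by
    obtain ⟨e, he, hx, P₀, h⟩ := exists_trivialization_of_idempotent hP hi x₀
    refine ⟨e, he, hx, LinearMap.ker P₀, fun x hx v => ?_⟩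
    have h1 : (e ⟨x, v⟩).2 = e.linearMapAt ℝ x v := by rw [e.coe_linearMapAt_of_mem hx]
    rw [h1]
    simp only [LinearMap.mem_ker, ← h x hx]
    rw [e.linearMapAt_def_of_mem hx]
    exact (LinearEquiv.map_eq_zero_iff _).symm
  isCompl x := by
    refine ⟨Submodule.disjoint_def.2 fun v h1 h2 => ?_, codisjoint_iff.2 <| eq_top_iff.2 fun v _ => ?_⟩
    · simp only [LinearMap.mem_ker, LinearMap.sub_apply, LinearMap.id_apply] at h1 h2
      simpa [h2] using h1
    · refine Submodule.mem_sup.2 ⟨P x v, ?_, v - P x v, ?_, by abel⟩ <;> simp [hi]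

end

/-- The projection onto the first summand of a splitting along the second one. -/
def Splitting.proj (S : Splitting F E) (x : X) : E x →ₗ[ℝ] E x :=
  (S.fst x).projection (S.snd x) (S.isCompl x)

variable (S : Splitting F E)

theorem Splitting.proj_mem (x : X) (v : E x) : S.proj x v ∈ S.fst x := by
  simp [Splitting.proj]

theorem Splitting.proj_of_mem_fst {x : X} {v : E x} (hv : v ∈ S.fst x) : S.proj x v = v :=
  Submodule.projection_apply_of_mem_left _ hv

theorem Splitting.proj_eq_zero_iff {x : X} {v : E x} : S.proj x v = 0 ↔ v ∈ S.snd x :=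
  Submodule.projection_apply_eq_zero_iff _

theorem Splitting.proj_proj (x : X) (v : E x) : S.proj x (S.proj x v) = S.proj x v :=
  S.proj_of_mem_fst (S.proj_mem x v)

theorem Splitting.sub_proj_mem (x : X) (v : E x) : v - S.proj x v ∈ S.snd x := by
  rw [← S.proj_eq_zero_iff, map_sub, S.proj_proj, sub_self]

/-- The two summands are constant in possibly different trivializations `e` and `e'`. Carrying each
component along by its own trivialization gives a continuous family `G` of operators that moves the
splitting at `x₀` to the one at `x`; in the coordinates of `e` the projection is `p * (G x)⁻¹` for
`x` near `x₀`. -/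
theorem Splitting.contEnd_proj [∀ x, TopologicalSpace (E x)] [FiberBundle F E]
    [VectorBundle ℝ F E] : ContEnd F S.proj := by
  have : CompleteSpace F := FiniteDimensional.complete ℝ F
  refine contEnd_of_continuousAt fun x₀ => ?_
  obtain ⟨e, he, hx₀, W, hW⟩ := S.isSubbundle_fst x₀
  obtain ⟨e', he', hx₀', W', hW'⟩ := S.isSubbundle_snd x₀
  refine ⟨e, he, hx₀, ?_⟩
  have hW₁ : ∀ x ∈ e.baseSet, ∀ v : E x, v ∈ S.fst x ↔ e.linearMapAt ℝ x v ∈ W := fun x hx v => by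
    rw [hW x hx v, e.coe_linearMapAt_of_mem hx]
  have hW₂ : ∀ x ∈ e'.baseSet, ∀ v : E x, v ∈ S.snd x ↔ e'.linearMapAt ℝ x v ∈ W' :=
    fun x hx v => by rw [hW' x hx v, e'.coe_linearMapAt_of_mem hx]
  set p := coordEnd e S.proj x₀ with hp
  have hpW : ∀ a, p a ∈ W := fun a => (hW₁ x₀ hx₀ _).1 (S.proj_mem _ _)
  let θ : F →L[ℝ] F := (e'.linearMapAt ℝ x₀ ∘ₗ e.symmₗ ℝ x₀).toContinuousLinearMap
  let ψ : X → F →L[ℝ] F := fun x => (e.linearMapAt ℝ x ∘ₗ e'.symmₗ ℝ x).toContinuousLinearMap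
  have hψ : ContinuousAt ψ x₀ := continuousAt_clm_apply.2 fun a =>
    ((continuousAt_mk_iff e (ξ := id) hx₀).1
      (continuousAt_mk_symmₗ e' (ξ := id) hx₀' continuousAt_id continuousAt_const)).2
  have hθ : ∀ a, θ (a - p a) ∈ W' := fun a => by
    have : θ (a - p a) = e'.linearMapAt ℝ x₀ (e.symmₗ ℝ x₀ a - S.proj x₀ (e.symmₗ ℝ x₀ a)) := by
      simp [θ, hp, coordEnd_apply, e.symmₗ_linearMapAt hx₀]
    rw [this]
    exact (hW₂ x₀ hx₀' _).1 (S.sub_proj_mem _ _)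
  -- Here `θ` passes from `e` to `e'` at `x₀`, and `ψ x` passes back from `e'` to `e` at `x`. The
  -- first term has values in the first summand over `x`, the second term in the second one.
  let G : X → F →L[ℝ] F := fun x => p + ψ x * (θ * (1 - p))
  have hG : ContinuousAt G x₀ := by fun_prop
  have hG₀ : G x₀ = 1 := by
    have h1 : ψ x₀ * θ = 1 := by
      ext a
      simp [ψ, θ, e'.symmₗ_linearMapAt hx₀', e.linearMapAt_symmₗ hx₀]
    simp only [G]
    rw [← mul_assoc, h1, one_mul, add_sub_cancel]
  have hu : IsUnit (G x₀) := hG₀ ▸ isUnit_one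
  have hinv : ContinuousAt (fun x => Ring.inverse (G x)) x₀ := by
    obtain ⟨u, hu⟩ := hu
    have := NormedRing.inverse_continuousAt u
    rw [hu] at this
    exact this.comp hG
  refine (continuousAt_const (y := p) |>.mul hinv).congr ?_
  filter_upwards [e.open_baseSet.mem_nhds hx₀, e'.open_baseSet.mem_nhds hx₀',
    hG (Units.isOpen.mem_nhds hu)] with x hx hx' hux
  have key : coordEnd e S.proj x * G x = p := by
    ext a
    have hGa : G x a = p a + e.linearMapAt ℝ x (e'.symmₗ ℝ x (θ (a - p a))) := rfl
    have h1 : S.proj x (e.symmₗ ℝ x (p a)) = e.symmₗ ℝ x (p a) := S.proj_of_mem_fst <| by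
      rw [hW₁ x hx, e.linearMapAt_symmₗ hx]
      exact hpW a
    have h2 : S.proj x (e'.symmₗ ℝ x (θ (a - p a))) = 0 := S.proj_eq_zero_iff.2 <| by
      rw [hW₂ x hx', e'.linearMapAt_symmₗ hx']
      exact hθ a
    rw [mul_apply_eq_comp, hGa, map_add, coordEnd_linearMapAt e _ hx, coordEnd_apply, h1, h2,
      map_zero, add_zero, e.linearMapAt_symmₗ hx]
  rw [Pi.mul_apply, ← key, mul_assoc, Ring.mul_inverse_cancel _ hux, mul_one]

end Projections

section Fiber

variable {X : Type*} [TopologicalSpace X] {E : X → Type*}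
  [∀ x, AddCommGroup (E x)] [∀ x, Module ℝ (E x)] [∀ x, TopologicalSpace (E x)]

theorem finiteDimensional_fiber (F : Type*) [NormedAddCommGroup F] [NormedSpace ℝ F]
    [FiniteDimensional ℝ F] [TopologicalSpace (TotalSpace F E)] [FiberBundle F E]
    [VectorBundle ℝ F E] (x : X) : FiniteDimensional ℝ (E x) :=
  ((trivializationAt F E x).linearEquivAt ℝ x
    (FiberBundle.mem_baseSet_trivializationAt F E x)).symm.finiteDimensional

theorem finrank_fiber (F : Type*) [NormedAddCommGroup F] [NormedSpace ℝ F]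
    [TopologicalSpace (TotalSpace F E)] [FiberBundle F E]
    [VectorBundle ℝ F E] (x : X) : Module.finrank ℝ (E x) = Module.finrank ℝ F :=
  ((trivializationAt F E x).linearEquivAt ℝ x
    (FiberBundle.mem_baseSet_trivializationAt F E x)).finrank_eq

end Fiber

/-! ### Existence and uniqueness of `q`-splittings -/

section Existence

set_option linter.unusedSectionVars false

variable {X : Type*} [TopologicalSpace X]
  {F : Type*} [NormedAddCommGroup F] [NormedSpace ℝ F] [FiniteDimensional ℝ F]
  {E : X → Type*} [TopologicalSpace (TotalSpace F E)]
  [∀ x, AddCommGroup (E x)] [∀ x, Module ℝ (E x)]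

/-- The symmetric bilinear form of a quadratic form on `E`. -/
def NondegQuadForm.bilin (q : NondegQuadForm F E) (x : X) : LinearMap.BilinForm ℝ (E x) :=
  QuadraticMap.associated (R := ℝ) (q.form x)

theorem NondegQuadForm.bilin_self (q : NondegQuadForm F E) (x : X) (v : E x) :
    q.bilin x v v = q.form x v :=
  QuadraticMap.associated_eq_self_apply ℝ (q.form x) v

theorem NondegQuadForm.contForm (q : NondegQuadForm F E) : ContForm F q.bilin where
  symm x v w := QuadraticMap.associated_isSymm ℝ (q.form x) v w
  cont := by
    simp only [q.bilin_self]
    exact q.continuous_form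

section Bundle

variable [∀ x, TopologicalSpace (E x)] [FiberBundle F E] [VectorBundle ℝ F E]

theorem ContEnd.exists_inverse {f : ∀ x, E x →ₗ[ℝ] E x} (hf : ContEnd F f)
    (hinj : ∀ x, Function.Injective (f x)) :
    ∃ g : ∀ x, E x →ₗ[ℝ] E x, ContEnd F g ∧ (∀ x v, g x (f x v) = v) ∧ ∀ x v, f x (g x v) = v := by
  have := finiteDimensional_fiber F (E := E)
  have h₁ : ∀ x v, (LinearEquiv.ofInjectiveEndo (f x) (hinj x)).symm (f x v) = v := fun x v =>
    (LinearEquiv.ofInjectiveEndo (f x) (hinj x)).symm_apply_apply v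
  have h₂ : ∀ x v, f x ((LinearEquiv.ofInjectiveEndo (f x) (hinj x)).symm v) = v := fun x v =>
    (LinearEquiv.ofInjectiveEndo (f x) (hinj x)).apply_symm_apply v
  exact ⟨fun x => (LinearEquiv.ofInjectiveEndo (f x) (hinj x)).symm.toLinearMap,
    hf.of_inverse h₁ h₂, h₁, h₂⟩

/-- Spectral projection without functional calculus: `|A|` is the transport from `h` to `h (A ·) (A
·)`, so its continuity is that of transport operators. -/
theorem NondegQuadForm.exists_polarization [ParacompactSpace X] [T2Space X]
    (q : NondegQuadForm F E) :
    ∃ P : ∀ x, E x →ₗ[ℝ] E x, ContEnd F P ∧ ∀ x, IsPolarization (q.bilin x) (P x) := by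
  have := finiteDimensional_fiber F (E := E)
  obtain ⟨h, hh, hm⟩ := exists_metric F E
  let A : ∀ x, E x →ₗ[ℝ] E x := fun x =>
    (q.bilin x).symmCompOfNondegenerate (h x) (hm x).nondegenerate
  have hA : ∀ x v w, h x (A x v) w = q.bilin x v w := fun x v w =>
    (q.bilin x).symmCompOfNondegenerate_left_apply (hm x).nondegenerate w v
  have hAc : ContEnd F A := contEnd_of_represents hh q.contForm hm hA
  have hA0 : ∀ x v, A x v = 0 → v = 0 := fun x v hv =>
    q.nondegenerate x v fun w => by
      have := hA x v w
      rw [hv, map_zero, LinearMap.zero_apply] at this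
      exact this.symm
  have hm' : ∀ x, IsMetric ((h x).compl₁₂ (A x) (A x)) := fun x =>
    ⟨fun v w => (hm x).symm _ _, fun v hv => (hm x).pos _ fun h0 => hv (hA0 x v h0)⟩
  choose l hl using fun x => exists_isTransport (hm x) (hm' x)
  have hlc : ContEnd F l := contEnd_of_isTransport hh (hh.pullback hAc) hm hm' hl
  obtain ⟨l', hlc', -, hll'⟩ := hlc.exists_inverse fun x => (hl x).injective
  exact ⟨_, (contEnd_id.add (hAc.comp hlc')).smul _, fun x =>
    isPolarization_of_isTransport (hm x) (q.contForm.symm x) (hA x) (hl x) (hll' x)⟩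

theorem Splitting.ofProjection_proj {P : ∀ x, E x →ₗ[ℝ] E x} (hP : ContEnd F P)
    (hi : ∀ x v, P x (P x v) = P x v) (x : X) (v : E x) :
    (Splitting.ofProjection P hP hi).proj x v = P x v := by
  set S := Splitting.ofProjection P hP hi
  have h1 : S.proj x (P x v) = P x v := S.proj_of_mem_fst <| by
    simp [S, Splitting.ofProjection, hi]
  have h2 : S.proj x (v - P x v) = 0 := S.proj_eq_zero_iff.2 <| by
    simp [S, Splitting.ofProjection, hi]
  rw [map_sub, h1] at h2
  exact sub_eq_zero.1 h2

/-- The polar metric is `q` on the image of `P` and `-q` on its kernel. -/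
theorem NondegQuadForm.isSplitting_ofProjection (q : NondegQuadForm F E)
    {P : ∀ x, E x →ₗ[ℝ] E x} (hP : ContEnd F P) (hs : ∀ x, IsPolarization (q.bilin x) (P x)) :
    q.IsSplitting (Splitting.ofProjection P hP fun x => (hs x).idem) := by
  refine fun x => ⟨fun v hv hv0 => ?_, fun v hv hv0 => ?_⟩ <;>
  · have h1 := (hs x).metric.pos v hv0
    simp only [Splitting.ofProjection, LinearMap.mem_ker, LinearMap.sub_apply,
      LinearMap.id_apply] at hv
    first
    | rw [sub_eq_zero] at hv
      rw [polar_apply, ← hv, q.bilin_self] at h1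
      linarith
    | rw [polar_apply, hv, q.bilin_self, map_zero, LinearMap.zero_apply] at h1
      linarith

end Bundle

theorem subbundlesIsomorphic_of_contEnd {f g : ∀ x, E x →ₗ[ℝ] E x} (hf : ContEnd F f)
    (hg : ContEnd F g) (h₁ : ∀ x v, g x (f x v) = v) (h₂ : ∀ x v, f x (g x v) = v)
    {S T : ∀ x, Submodule ℝ (E x)} (hST : ∀ x, ∀ v ∈ S x, f x v ∈ T x)
    (hTS : ∀ x, ∀ v ∈ T x, g x v ∈ S x) : SubbundlesIsomorphic F S T :=
  ⟨fun x => LinearEquiv.ofLinearMap ((f x).restrict (hST x)) ((g x).restrict (hTS x))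
      (LinearMap.ext fun v => Subtype.ext (h₂ x v)) (LinearMap.ext fun v => Subtype.ext (h₁ x v)),
    (Continuous.comp hf continuous_subtype_val).subtype_mk _,
    (Continuous.comp hg continuous_subtype_val).subtype_mk _⟩

theorem Splitting.mem_fst_iff (S : Splitting F E) {x : X} {v : E x} :
    v ∈ S.fst x ↔ S.proj x v = v :=
  ⟨S.proj_of_mem_fst, fun h => h ▸ S.proj_mem x v⟩

variable [∀ x, TopologicalSpace (E x)] [FiberBundle F E] [VectorBundle ℝ F E]

/-- Splittings related by a continuous automorphism are isomorphic. -/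
theorem Splitting.equiv_of_contEnd {S T : Splitting F E} {f : ∀ x, E x →ₗ[ℝ] E x}
    (hf : ContEnd F f) (hinj : ∀ x, Function.Injective (f x))
    (h : ∀ x v, f x (S.proj x v) = T.proj x (f x v)) : S ≈ T := by
  obtain ⟨g, hg, h₁, h₂⟩ := hf.exists_inverse hinj
  have h' : ∀ x v, g x (T.proj x v) = S.proj x (g x v) := fun x v => by
    apply hinj x
    rw [h₂, h, h₂]
  refine ⟨subbundlesIsomorphic_of_contEnd hf hg h₁ h₂ (fun x v hv => ?_) fun x v hv => ?_,
    subbundlesIsomorphic_of_contEnd hf hg h₁ h₂ (fun x v hv => ?_) fun x v hv => ?_⟩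
  · rw [T.mem_fst_iff, ← h, S.proj_of_mem_fst hv]
  · rw [S.mem_fst_iff, ← h', T.proj_of_mem_fst hv]
  · rw [← T.proj_eq_zero_iff, ← h, S.proj_eq_zero_iff.2 hv, map_zero]
  · rw [← S.proj_eq_zero_iff, ← h', T.proj_eq_zero_iff.2 hv, map_zero]

/-- Isomorphic splittings are related by a continuous automorphism. -/
theorem Splitting.exists_contEnd_of_equiv {S T : Splitting F E} (h : S ≈ T) :
    ∃ f : ∀ x, E x →ₗ[ℝ] E x, ContEnd F f ∧ (∀ x, Function.Injective (f x)) ∧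
      ∀ x v, f x (S.proj x v) = T.proj x (f x v) := by
  obtain ⟨⟨a, ha, -⟩, ⟨c, hc, -⟩⟩ := h
  -- The automorphism is the direct sum of the isomorphisms `a` and `c`, extended to `E` by means of
  -- the projections.
  let f₁ : ∀ x, E x →ₗ[ℝ] E x := fun x =>
    (T.fst x).subtype ∘ₗ (a x).toLinearMap ∘ₗ (S.proj x).codRestrict (S.fst x) (S.proj_mem x)
  let f₂ : ∀ x, E x →ₗ[ℝ] E x := fun x =>
    (T.snd x).subtype ∘ₗ (c x).toLinearMap ∘ₗ
      (LinearMap.id - S.proj x).codRestrict (S.snd x) (S.sub_proj_mem x)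
  have hS := S.contEnd_proj
  have hS' : ContEnd F fun x => LinearMap.id - S.proj x := by
    have := contEnd_id.add (hS.smul (-1))
    simpa only [neg_smul, one_smul, ← sub_eq_add_neg] using this
  have hf₁ : ContEnd F f₁ :=
    continuous_subtype_val.comp (ha.comp (Continuous.subtype_mk hS fun v => S.proj_mem _ _))
  have hf₂ : ContEnd F f₂ :=
    continuous_subtype_val.comp (hc.comp (Continuous.subtype_mk hS' fun v => S.sub_proj_mem _ _))
  have hm₁ : ∀ x v, T.proj x (f₁ x v) = f₁ x v := fun x v => T.proj_of_mem_fst (Subtype.prop _)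
  have hm₂ : ∀ x v, T.proj x (f₂ x v) = 0 := fun x v => T.proj_eq_zero_iff.2 (Subtype.prop _)
  have hk₁ : ∀ x v, f₁ x v = 0 → S.proj x v = 0 := fun x v hv => by
    have : (S.proj x).codRestrict (S.fst x) (S.proj_mem x) v = 0 :=
      (a x).map_eq_zero_iff.1 (Subtype.ext hv)
    exact congrArg Subtype.val this
  have hk₂ : ∀ x v, f₂ x v = 0 → v - S.proj x v = 0 := fun x v hv => by
    have : (LinearMap.id - S.proj x).codRestrict (S.snd x) (S.sub_proj_mem x) v = 0 :=
      (c x).map_eq_zero_iff.1 (Subtype.ext hv)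
    exact congrArg Subtype.val this
  have hp₁ : ∀ x v, f₁ x (S.proj x v) = f₁ x v := fun x v => by
    have : (S.proj x).codRestrict (S.fst x) (S.proj_mem x) (S.proj x v) =
        (S.proj x).codRestrict (S.fst x) (S.proj_mem x) v := Subtype.ext (S.proj_proj x v)
    simp only [f₁, LinearMap.comp_apply, this]
  have hp₂ : ∀ x v, f₂ x (S.proj x v) = 0 := fun x v => by
    have : (LinearMap.id - S.proj x).codRestrict (S.snd x) (S.sub_proj_mem x) (S.proj x v) = 0 :=
      Subtype.ext (by simp [S.proj_proj])
    simp only [f₂, LinearMap.comp_apply, this, map_zero]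
  refine ⟨fun x => f₁ x + f₂ x, hf₁.add hf₂, fun x => ?_, fun x v => ?_⟩
  · rw [injective_iff_map_eq_zero]
    intro v hv
    rw [LinearMap.add_apply] at hv
    have h1 := congrArg (T.proj x) hv
    rw [map_add, hm₁, hm₂, add_zero, map_zero] at h1
    rw [h1, zero_add] at hv
    have := hk₂ x v hv
    rwa [hk₁ x v h1, sub_zero] at this
  · rw [LinearMap.add_apply, LinearMap.add_apply, map_add, hm₁, hm₂, hp₁, hp₂]

/-- Any two `q`-splittings are isomorphic. -/
theorem NondegQuadForm.IsSplitting.equiv {q : NondegQuadForm F E} {S T : Splitting F E}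
    (hS : q.IsSplitting S) (hT : q.IsSplitting T) : S ≈ T := by
  have hS' : ContEnd F fun x => LinearMap.id + (-1 : ℝ) • S.proj x :=
    contEnd_id.add (S.contEnd_proj.smul (-1))
  have hT' : ContEnd F fun x => LinearMap.id + (-1 : ℝ) • T.proj x :=
    contEnd_id.add (T.contEnd_proj.smul (-1))
  have hST : ∀ x v, v ∈ S.fst x → v ∈ T.snd x → v = 0 := fun x v h1 h2 => by
    by_contra h0
    exact lt_asymm ((hS x).1 v h1 h0) ((hT x).2 v h2 h0)
  have hTS : ∀ x v, v ∈ S.snd x → v ∈ T.fst x → v = 0 := fun x v h1 h2 => by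
    by_contra h0
    exact lt_asymm ((hS x).2 v h1 h0) ((hT x).1 v h2 h0)
  -- The operator `TS + (1 - T)(1 - S)` intertwines `S` with `T` for any two projections.
  -- Definiteness enters only through its injectivity: if `v` is in the kernel, then `S v` lies in
  -- `S.fst` and `T.snd`, so it is `0`, and then `v` lies in `S.snd` and `T.fst`.
  have happ : ∀ x (v : E x), (T.proj x ∘ₗ S.proj x + (LinearMap.id + (-1 : ℝ) • T.proj x) ∘ₗ
      (LinearMap.id + (-1 : ℝ) • S.proj x) : E x →ₗ[ℝ] E x) v =
      T.proj x (S.proj x v) + (v - S.proj x v - T.proj x (v - S.proj x v)) := fun x v => by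
    simp only [LinearMap.add_apply, LinearMap.comp_apply, LinearMap.sub_apply, LinearMap.id_apply,
      neg_smul, one_smul, ← sub_eq_add_neg]
  refine Splitting.equiv_of_contEnd ((T.contEnd_proj.comp S.contEnd_proj).add (hT'.comp hS'))
    (fun x => ?_) fun x v => ?_
  · rw [injective_iff_map_eq_zero]
    intro v hv
    rw [happ] at hv
    have h1 := congrArg (T.proj x) hv
    rw [map_add, map_sub (T.proj x) (v - S.proj x v), T.proj_proj, T.proj_proj, sub_self, add_zero,
      map_zero] at h1
    have h2 := hST x _ (S.proj_mem x v) (T.proj_eq_zero_iff.1 h1)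
    rw [h2, map_zero, zero_add, sub_zero, sub_eq_zero] at hv
    exact hTS x v (S.proj_eq_zero_iff.1 h2) (T.mem_fst_iff.2 hv.symm)
  · rw [happ, happ, map_add, map_sub (T.proj x) (v - S.proj x v), T.proj_proj, T.proj_proj,
      S.proj_proj]
    simp

theorem NondegQuadForm.exists_isSplitting [ParacompactSpace X] [T2Space X]
    (q : NondegQuadForm F E) : ∃ S : Splitting F E, q.IsSplitting S := by
  obtain ⟨P, hP, hs⟩ := q.exists_polarization
  exact ⟨_, q.isSplitting_ofProjection hP hs⟩

/-- The splitting chosen in the definition is isomorphic to `S`, and the default branch is excluded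
by `S` itself. -/
theorem NondegQuadForm.IsSplitting.theta_eq {q : NondegQuadForm F E} {S : Splitting F E}
    (hS : q.IsSplitting S) : q.theta = Quotient.mk _ S := by
  have h : ∃ S : Splitting F E, q.IsSplitting S := ⟨S, hS⟩
  rw [NondegQuadForm.theta, dif_pos h]
  exact Quotient.sound (h.choose_spec.equiv hS)

end Existence

/-! ### Orthonormal bases of a non-degenerate form -/

section OrthonormalBasis

variable {V : Type*} [AddCommGroup V] [Module ℝ V] [FiniteDimensional ℝ V]

/-- Sylvester's law of inertia, in terms of orthonormal bases. -/
theorem exists_basis_eq_signMatrix (Q : QuadraticForm ℝ V)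
    (hQ : (QuadraticMap.associated (R := ℝ) Q).SeparatingLeft) :
    ∃ b : Module.Basis (Fin (sigPos Q) ⊕ Fin (sigNeg Q)) ℝ V, ∀ i j,
      QuadraticMap.associated (R := ℝ) Q (b i) (b j) = signMatrix (sigPos Q) (sigNeg Q) i j := by
  obtain ⟨w, hw, hQw⟩ := Q.equivalent_one_neg_one_weighted_sum_squared hQ
  have hp := QuadraticForm.sigPos_of_equiv_weightedSumSquares hQw
  have hm := QuadraticForm.sigNeg_of_equiv_weightedSumSquares hQw
  obtain ⟨φ⟩ := hQw
  have e₁ : {i // 0 < w i} ≃ Fin (sigPos Q) := Finite.equivFinOfCardEq hp.symm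
  have e₂ : {i // ¬ 0 < w i} ≃ Fin (sigNeg Q) :=
    (Equiv.subtypeEquivRight fun i => by rcases hw i with h | h <;> simp [h]).trans
      (Finite.equivFinOfCardEq (α := {i // w i < 0}) hm.symm)
  classical
  -- Sorts the diagonalizing coordinates: weights `1` to the left, weights `-1` to the right.
  let σ := ((Equiv.sumCompl fun i => 0 < w i).symm.trans (e₁.sumCongr e₂))
  have hσ₁ : ∀ i, w (σ.symm (Sum.inl i)) = 1 := fun i => by
    have h1 : 0 < w (σ.symm (Sum.inl i)) := (e₁.symm i).2
    rcases hw (σ.symm (Sum.inl i)) with h | h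
    · rw [h] at h1
      norm_num at h1
    · exact h
  have hσ₂ : ∀ i, w (σ.symm (Sum.inr i)) = -1 := fun i => by
    have h1 : ¬ 0 < w (σ.symm (Sum.inr i)) := (e₂.symm i).2
    rcases hw (σ.symm (Sum.inr i)) with h | h
    · exact h
    · rw [h] at h1
      norm_num at h1
  let b := ((Pi.basisFun ℝ _).map φ.toLinearEquiv.symm).reindex σ
  have hb : ∀ i, φ (b i) = Pi.single (σ.symm i) 1 := fun i => by
    have : b i = φ.toLinearEquiv.symm (Pi.single (σ.symm i) 1) := by simp [b]
    rw [this]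
    exact φ.toLinearEquiv.apply_symm_apply _
  have hQv : ∀ v, Q v = ∑ i, w i * (φ v i * φ v i) := fun v => by
    rw [← φ.map_app v, QuadraticMap.weightedSumSquares_apply]
    simp only [smul_eq_mul]
  have hB : ∀ v u, QuadraticMap.associated (R := ℝ) Q v u = ∑ i, w i * (φ v i * φ u i) :=
    fun v u => by
    have hadd : ∀ i, φ (v + u) i = φ v i + φ u i := fun i => congrFun (map_add φ v u) i
    have hself := QuadraticMap.associated_eq_self_apply ℝ Q
    have h1 := hself (v + u)
    have h2 : QuadraticMap.associated (R := ℝ) Q u v = QuadraticMap.associated (R := ℝ) Q v u :=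
      QuadraticMap.associated_isSymm ℝ Q u v
    have h3 : ∑ i, w i * ((φ v i + φ u i) * (φ v i + φ u i)) = ∑ i, w i * (φ v i * φ v i) +
        ∑ i, w i * (φ u i * φ u i) + 2 * ∑ i, w i * (φ v i * φ u i) := by
      rw [Finset.mul_sum, ← Finset.sum_add_distrib, ← Finset.sum_add_distrib]
      exact Finset.sum_congr rfl fun i _ => by ring
    simp only [map_add, LinearMap.add_apply, hself, h2] at h1
    rw [hQv (v + u), hQv v, hQv u] at h1
    simp only [hadd] at h1
    linarith
  refine ⟨b, fun i j => ?_⟩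
  rw [hB, hb, hb, Finset.sum_eq_single (σ.symm i) (fun k _ hk => by simp [hk]) (by simp)]
  rcases eq_or_ne i j with rfl | hij
  · rcases i with i | i <;>
      simp [hσ₁, hσ₂, signMatrix, LieAlgebra.Orthogonal.indefiniteDiagonal]
  · simp [signMatrix, LieAlgebra.Orthogonal.indefiniteDiagonal, hij]

end OrthonormalBasis

/-! ### Local isometries, constancy of the inertia, local frames -/

section LocalIsometry

set_option linter.unusedSectionVars false

variable {X : Type*} [TopologicalSpace X]
  {F : Type*} [NormedAddCommGroup F] [NormedSpace ℝ F] [FiniteDimensional ℝ F]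
  {E : X → Type*} [TopologicalSpace (TotalSpace F E)]
  [∀ x, AddCommGroup (E x)] [∀ x, Module ℝ (E x)]
  [∀ x, TopologicalSpace (E x)] [FiberBundle F E] [VectorBundle ℝ F E]
  [ParacompactSpace X] [T2Space X]

/-- Nearby fibres are isometric to a given one, through a continuous family of isometries. -/
theorem NondegQuadForm.exists_local_isometry (q : NondegQuadForm F E) (x₀ : X) :
    ∃ k : ∀ x, E x₀ →ₗ[ℝ] E x,
      (∀ᶠ x in 𝓝 x₀, ∀ v w, q.bilin x (k x v) (k x w) = q.bilin x₀ v w) ∧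
      ∀ u, ContinuousAt (fun x => (⟨x, k x u⟩ : TotalSpace F E)) x₀ := by
  obtain ⟨P, hP, hs⟩ := q.exists_polarization
  -- In this trivialization all the forms `q.bilin x` have the same polarization `P₀`, so the
  -- transport between the polar metrics at `x` and at `x₀` is an isometry of the forms themselves.
  obtain ⟨e, he, hx₀, P₀, hP₀⟩ := exists_trivialization_of_idempotent hP (fun x => (hs x).idem) x₀
  let b : X → LinearMap.BilinForm ℝ F := fun x => toBilin (coordForm e q.bilin x)
  let h : X → F →L[ℝ] F →L[ℝ] ℝ := coordForm e fun x => polar (q.bilin x) (P x)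
  have hsymm : ∀ x ∈ e.baseSet, ∀ a, P x (e.symmₗ ℝ x a) = e.symmₗ ℝ x (P₀ a) := fun x hx a => by
    rw [← e.symmₗ_linearMapAt (R := ℝ) hx (P x _), hP₀ x hx, e.linearMapAt_symmₗ hx]
  have hb : ∀ x v w, b x v w = q.bilin x (e.symmₗ ℝ x v) (e.symmₗ ℝ x w) := fun _ _ _ => rfl
  have hpol : ∀ x ∈ e.baseSet, polar (b x) P₀ = toBilin (h x) := fun x hx => by
    ext v w
    rw [polar_apply, hb, hb, ← hsymm x hx, toBilin_apply, coordForm_apply, polar_apply]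
  have hm : ∀ x ∈ e.baseSet, IsMetric (toBilin (h x)) := fun x hx =>
    isMetric_coordForm hx (hs x).metric
  have hsb : ∀ x ∈ e.baseSet, IsPolarization (b x) P₀ := fun x hx =>
    { idem := fun a => by
        rw [← e.linearMapAt_symmₗ (R := ℝ) hx (P₀ (P₀ a)), ← hsymm x hx, ← hsymm x hx, (hs x).idem,
          hsymm x hx, e.linearMapAt_symmₗ hx]
      selfAdj := fun v w => by rw [hb, hb, ← hsymm x hx, ← hsymm x hx, (hs x).selfAdj]
      metric := hpol x hx ▸ hm x hx }
  have hex : ∀ x, ∃ l : F →ₗ[ℝ] F, x ∈ e.baseSet →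
      IsTransport (toBilin (h x)) (toBilin (h x₀)) l := fun x => by
    by_cases hx : x ∈ e.baseSet
    · exact (exists_isTransport (hm x hx) (hm x₀ hx₀)).imp fun l hl _ => hl
    · exact ⟨0, fun h => absurd h hx⟩
  choose l hl using hex
  have hbase := e.open_baseSet.mem_nhds hx₀
  have hlc : ContinuousAt (fun x => (l x).toContinuousLinearMap) x₀ :=
    continuousAt_of_isTransport
      ((q.contForm.polar hP hs).continuousAt_coordForm e hx₀) continuousAt_const (hm x₀ hx₀)
      (hm x₀ hx₀) (by filter_upwards [hbase] with x hx using hl x hx)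
  refine ⟨fun x => e.symmₗ ℝ x ∘ₗ l x ∘ₗ e.linearMapAt ℝ x₀, ?_, fun u => ?_⟩
  · filter_upwards [hbase] with x hx v w
    have hlx := hl x hx
    rw [← hpol x hx, ← hpol x₀ hx₀] at hlx
    have := (hsb x hx).map_transport (hsb x₀ hx₀) hlx (e.linearMapAt ℝ x₀ v) (e.linearMapAt ℝ x₀ w)
    rwa [hb, hb, e.symmₗ_linearMapAt hx₀, e.symmₗ_linearMapAt hx₀] at this
  · exact continuousAt_mk_symmₗ e (ξ := id) hx₀ continuousAt_id
      (hlc.clm_apply continuousAt_const)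

theorem NondegQuadForm.injective_of_isometry (q : NondegQuadForm F E) {x₀ : X} {V : Type*}
    [AddCommGroup V] [Module ℝ V] {c : LinearMap.BilinForm ℝ V} {k : E x₀ →ₗ[ℝ] V}
    (hk : ∀ v w, c (k v) (k w) = q.bilin x₀ v w) : Function.Injective k := by
  rw [injective_iff_map_eq_zero]
  intro v hv
  refine q.nondegenerate x₀ v fun w => ?_
  have := hk v w
  rw [hv, map_zero, LinearMap.zero_apply] at this
  exact this.symm

/-- An isometry between two fibres, as a linear equivalence. -/
def NondegQuadForm.fiberEquiv (q : NondegQuadForm F E) {x₀ x : X} {c : LinearMap.BilinForm ℝ (E x)}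
    {k : E x₀ →ₗ[ℝ] E x} (hk : ∀ v w, c (k v) (k w) = q.bilin x₀ v w) : E x₀ ≃ₗ[ℝ] E x :=
  haveI := finiteDimensional_fiber F (E := E) x₀
  haveI := finiteDimensional_fiber F (E := E) x
  LinearEquiv.ofInjectiveOfFinrankEq k (q.injective_of_isometry hk)
    ((finrank_fiber F x₀).trans (finrank_fiber F x).symm)

theorem NondegQuadForm.fiberEquiv_apply (q : NondegQuadForm F E) {x₀ x : X}
    {c : LinearMap.BilinForm ℝ (E x)} {k : E x₀ →ₗ[ℝ] E x}
    (hk : ∀ v w, c (k v) (k w) = q.bilin x₀ v w) (v : E x₀) : q.fiberEquiv hk v = k v := rfl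

theorem equivalent_of_isometry (q q' : NondegQuadForm F E) {x₀ x : X} {k : E x₀ →ₗ[ℝ] E x}
    (hk : ∀ v w, q'.bilin x (k v) (k w) = q.bilin x₀ v w) :
    QuadraticMap.Equivalent (q.form x₀) (q'.form x) :=
  ⟨{ q.fiberEquiv hk with
      map_app' := fun v => by
        rw [← q'.bilin_self, ← q.bilin_self]
        exact hk v v }⟩

/-- The inertia of a quadratic form is constant on a connected base. -/
theorem NondegQuadForm.exists_hasInertia [ConnectedSpace X] (q : NondegQuadForm F E) :
    ∃ p m : ℕ, q.HasInertia p m := by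
  -- Nearby fibres are isometric, hence have equal inertia.
  have hloc : IsLocallyConstant fun x => (sigPos (q.form x), sigNeg (q.form x)) := by
    rw [IsLocallyConstant.iff_eventually_eq]
    intro x₀
    obtain ⟨k, hk, -⟩ := q.exists_local_isometry x₀
    filter_upwards [hk] with x hx
    have := equivalent_of_isometry q q hx
    rw [this.sigPos_eq, this.sigNeg_eq]
  obtain ⟨x₀⟩ := (inferInstance : Nonempty X)
  refine ⟨sigPos (q.form x₀), sigNeg (q.form x₀), fun x => ?_⟩
  exact Prod.ext_iff.1 (hloc.apply_eq_of_isPreconnected isPreconnected_univ trivial trivial)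

/-- Around each point there is a family of orthonormal frames which is continuous at that point. -/
theorem NondegQuadForm.HasInertia.exists_frames {q : NondegQuadForm F E} {p m : ℕ}
    (hq : q.HasInertia p m) (x₀ : X) :
    ∃ s : ∀ x, Module.Basis (Fin p ⊕ Fin m) ℝ (E x),
      (∀ x i j, q.bilin x (s x i) (s x j) = signMatrix p m i j) ∧
      ∀ i, ContinuousAt (fun x => (⟨x, s x i⟩ : TotalSpace F E)) x₀ := by
  have hfin := finiteDimensional_fiber F (E := E)
  have hex : ∀ x, ∃ b : Module.Basis (Fin p ⊕ Fin m) ℝ (E x), ∀ i j,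
      q.bilin x (b i) (b j) = signMatrix p m i j := fun x => by
    have h := exists_basis_eq_signMatrix (q.form x) (q.nondegenerate x)
    rw [(hq x).1, (hq x).2] at h
    exact h
  obtain ⟨ε, hε⟩ := hex x₀
  obtain ⟨k, hk, hkc⟩ := q.exists_local_isometry x₀
  -- Where `k x` is an isometry, the frame is the image of `ε`; elsewhere any orthonormal frame
  -- does, since only a neighbourhood of `x₀` matters for the continuity.
  have hs : ∀ x, ∃ s : Module.Basis (Fin p ⊕ Fin m) ℝ (E x),
      (∀ i j, q.bilin x (s i) (s j) = signMatrix p m i j) ∧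
      ((∀ v w, q.bilin x (k x v) (k x w) = q.bilin x₀ v w) → ∀ i, s i = k x (ε i)) := fun x => by
    by_cases hx : ∀ v w, q.bilin x (k x v) (k x w) = q.bilin x₀ v w
    · have happ : ∀ i, ε.map (q.fiberEquiv hx) i = k x (ε i) := fun i => by
        rw [Module.Basis.map_apply, q.fiberEquiv_apply]
      exact ⟨ε.map (q.fiberEquiv hx), fun i j => by rw [happ, happ, hx, hε], fun _ => happ⟩
    · obtain ⟨b, hb⟩ := hex x
      exact ⟨b, hb, fun h => absurd h hx⟩
  choose s hs₁ hs₂ using hs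
  refine ⟨s, hs₁, fun i => (hkc (ε i)).congr ?_⟩
  filter_upwards [hk] with x hx
  rw [hs₂ x hx]

end LocalIsometry

/-! ### Isometries versus isomorphic splittings -/

section Isometries

set_option linter.unusedSectionVars false

variable {X : Type*} [TopologicalSpace X]
  {F : Type*} [NormedAddCommGroup F] [NormedSpace ℝ F] [FiniteDimensional ℝ F]
  {E : X → Type*} [TopologicalSpace (TotalSpace F E)]
  [∀ x, AddCommGroup (E x)] [∀ x, Module ℝ (E x)]

/-- The map between bundles of orthonormal frames induced by fibrewise isometries. -/
def OrthoFrame.map {q₀ q₁ : NondegQuadForm F E} {p m : ℕ} (f : ∀ x, E x ≃ₗ[ℝ] E x)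
    (hf : ∀ x v w, q₁.bilin x (f x v) (f x w) = q₀.bilin x v w) (u : OrthoFrame q₀ p m) :
    OrthoFrame q₁ p m where
  base := u.base
  basis := u.basis.map (f u.base)
  orthonormal i j := by
    rw [Module.Basis.map_apply, Module.Basis.map_apply]
    exact (hf _ _ _).trans (u.orthonormal i j)

theorem OrthoFrame.continuous_map {q₀ q₁ : NondegQuadForm F E} {p m : ℕ}
    {f : ∀ x, E x ≃ₗ[ℝ] E x} (hf : ∀ x v w, q₁.bilin x (f x v) (f x w) = q₀.bilin x v w)
    (hc : ContEnd F fun x => (f x).toLinearMap) :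
    Continuous (OrthoFrame.map f hf : OrthoFrame q₀ p m → OrthoFrame q₁ p m) := by
  have h : Continuous fun u : OrthoFrame q₀ p m =>
      ((u.base, fun i => ⟨u.base, u.basis i⟩) : X × (Fin p ⊕ Fin m → TotalSpace F E)) :=
    continuous_induced_dom
  refine continuous_induced_rng.2 ((continuous_fst.comp h).prodMk (continuous_pi fun i => ?_))
  have h1 := Continuous.comp hc ((continuous_apply i).comp (continuous_snd.comp h))
  exact h1.congr fun u => congrArg (TotalSpace.mk u.base) (Module.Basis.map_apply _ _ _).symm

/-- A continuous isometry induces an isomorphism of bundles of orthonormal frames. -/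
theorem nonempty_principalIso {q₀ q₁ : NondegQuadForm F E} (p m : ℕ) (f : ∀ x, E x ≃ₗ[ℝ] E x)
    (hf : ∀ x v w, q₁.bilin x (f x v) (f x w) = q₀.bilin x v w)
    (hc : ContEnd F fun x => (f x).toLinearMap)
    (hc' : ContEnd F fun x => (f x).symm.toLinearMap) :
    Nonempty (PrincipalIso (indefiniteOrthogonalGroup p m)
      (OrthoFrame.base : OrthoFrame q₀ p m → X) (OrthoFrame.base : OrthoFrame q₁ p m → X)) := by
  have hf' : ∀ x v w, q₀.bilin x ((f x).symm v) ((f x).symm w) = q₁.bilin x v w := fun x v w => by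
    rw [← hf, LinearEquiv.apply_symm_apply, LinearEquiv.apply_symm_apply]
  refine ⟨⟨⟨⟨OrthoFrame.map f hf, OrthoFrame.map (fun x => (f x).symm) hf', fun u => ?_,
    fun u => ?_⟩, OrthoFrame.continuous_map hf hc, OrthoFrame.continuous_map hf' hc'⟩,
    fun _ => rfl, fun g u => ?_⟩⟩
  · refine OrthoFrame.ext rfl (heq_of_eq (Module.Basis.eq_of_apply_eq fun i => ?_))
    simp only [OrthoFrame.map]
    exact (f u.base).symm_apply_apply _
  · refine OrthoFrame.ext rfl (heq_of_eq (Module.Basis.eq_of_apply_eq fun i => ?_))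
    simp only [OrthoFrame.map]
    exact (f u.base).apply_symm_apply _
  · refine OrthoFrame.ext rfl (heq_of_eq (Module.Basis.eq_of_apply_eq fun i => ?_))
    change (OrthoFrame.basisMul u.basis g.1).map (f u.base) i =
      OrthoFrame.basisMul (u.basis.map (f u.base)) g.1 i
    simp [OrthoFrame.basisMul_apply]

variable [∀ x, TopologicalSpace (E x)] [FiberBundle F E] [VectorBundle ℝ F E]
  [ParacompactSpace X] [T2Space X]

/-- Forms with isomorphic splittings are isometric. -/
theorem exists_isometry_of_theta_eq {q₀ q₁ : NondegQuadForm F E} (h : q₀.theta = q₁.theta) :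
    ∃ f : ∀ x, E x →ₗ[ℝ] E x, ContEnd F f ∧
      ∀ x v w, q₁.bilin x (f x v) (f x w) = q₀.bilin x v w := by
  have hfin := finiteDimensional_fiber F (E := E)
  obtain ⟨P₀, hP₀, hs₀⟩ := q₀.exists_polarization
  obtain ⟨P₁, hP₁, hs₁⟩ := q₁.exists_polarization
  rw [(q₀.isSplitting_ofProjection hP₀ hs₀).theta_eq,
    (q₁.isSplitting_ofProjection hP₁ hs₁).theta_eq] at h
  obtain ⟨g, hg, hinj, hgP⟩ := Splitting.exists_contEnd_of_equiv (Quotient.exact h)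
  simp only [Splitting.ofProjection_proj] at hgP
  -- Pulling `q₁` back by `g` turns its polarization `P₁` into `P₀`, so `c` and `q₀` share a
  -- polarization, and the transport `l` carries `c` to `q₀`.
  let c : ∀ x, LinearMap.BilinForm ℝ (E x) := fun x => (q₁.bilin x).compl₁₂ (g x) (g x)
  have hc : ∀ x v w, c x v w = q₁.bilin x (g x v) (g x w) := fun _ _ _ => rfl
  have hpol : ∀ x v w, polar (c x) (P₀ x) v w = polar (q₁.bilin x) (P₁ x) (g x v) (g x w) :=
    fun x v w => by rw [polar_apply, polar_apply, hc, hc, hgP]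
  have hsc : ∀ x, IsPolarization (c x) (P₀ x) := fun x =>
    { idem := (hs₀ x).idem
      selfAdj := fun v w => by rw [hc, hc, hgP, hgP, (hs₁ x).selfAdj]
      metric :=
        { symm := fun v w => by rw [hpol, hpol, (hs₁ x).metric.symm]
          pos := fun v hv => by
            rw [hpol]
            exact (hs₁ x).metric.pos _ ((map_ne_zero_iff _ (hinj x)).2 hv) } }
  choose l hl using fun x => exists_isTransport (hsc x).metric (hs₀ x).metric
  have hlc : ContEnd F l := contEnd_of_isTransport
    ((q₁.contForm.pullback hg).polar hP₀ hsc) (q₀.contForm.polar hP₀ hs₀)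
    (fun x => (hsc x).metric) (fun x => (hs₀ x).metric) hl
  exact ⟨fun x => g x ∘ₗ l x, hg.comp hlc, fun x v w =>
    (hsc x).map_transport (hs₀ x) (hl x) v w⟩

/-- An isometry preserves the inertia, which connectedness makes constant, and maps orthonormal
frames to orthonormal frames. -/
theorem frameBundlesIsomorphic_of_theta_eq [ConnectedSpace X] {q₀ q₁ : NondegQuadForm F E}
    (h : q₀.theta = q₁.theta) : FrameBundlesIsomorphic q₀ q₁ := by
  obtain ⟨f, hc, hf⟩ := exists_isometry_of_theta_eq h
  obtain ⟨p, m, hpm⟩ := q₀.exists_hasInertia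
  let φ : ∀ x, E x ≃ₗ[ℝ] E x := fun x => q₀.fiberEquiv (hf x)
  refine ⟨p, m, hpm, fun x => ?_, nonempty_principalIso p m φ hf hc
    (hc.of_inverse (fun x => (φ x).symm_apply_apply) fun x => (φ x).apply_symm_apply)⟩
  have := equivalent_of_isometry q₀ q₁ (hf x)
  rw [← this.sigPos_eq, ← this.sigNeg_eq]
  exact hpm x

/-- Isometric forms have isomorphic splittings. -/
theorem theta_eq_of_isometry {q₀ q₁ : NondegQuadForm F E} {f : ∀ x, E x →ₗ[ℝ] E x}
    (hc : ContEnd F f) (hf : ∀ x v w, q₁.bilin x (f x v) (f x w) = q₀.bilin x v w) :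
    q₀.theta = q₁.theta := by
  obtain ⟨P, hP, hs⟩ := q₀.exists_polarization
  have hinj : ∀ x, Function.Injective (f x) := fun x => q₀.injective_of_isometry (hf x)
  obtain ⟨g, hg, h₁, h₂⟩ := hc.exists_inverse hinj
  -- The conjugate of `P` by the isometry polarizes `q₁`, and `f` matches the two splittings by
  -- construction.
  have hQ : ContEnd F fun x => f x ∘ₗ P x ∘ₗ g x := hc.comp (hP.comp hg)
  have hsQ : ∀ x, IsPolarization (q₁.bilin x) (f x ∘ₗ P x ∘ₗ g x) := fun x => by
    have hfg : ∀ v w, q₁.bilin x (f x v) w = q₀.bilin x v (g x w) := fun v w => by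
      rw [← hf, h₂]
    have hfg' : ∀ v w, q₁.bilin x v (f x w) = q₀.bilin x (g x v) w := fun v w => by
      rw [← hf, h₂]
    have hg' : ∀ v w, q₁.bilin x v w = q₀.bilin x (g x v) (g x w) := fun v w => by
      rw [← hf, h₂, h₂]
    have hpol : ∀ v w, polar (q₁.bilin x) (f x ∘ₗ P x ∘ₗ g x) v w =
        polar (q₀.bilin x) (P x) (g x v) (g x w) := fun v w => by
      rw [polar_apply, polar_apply, hg' v w]
      simp only [LinearMap.comp_apply, hfg]
    refine ⟨fun v => ?_, fun v w => ?_, fun v w => ?_, fun v hv => ?_⟩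
    · simp only [LinearMap.comp_apply, h₁, (hs x).idem]
    · simp only [LinearMap.comp_apply, hfg, hfg', (hs x).selfAdj]
    · rw [hpol, hpol, (hs x).metric.symm]
    · rw [hpol]
      refine (hs x).metric.pos _ fun h0 => hv ?_
      rw [← h₂ x v, h0, map_zero]
  rw [(q₀.isSplitting_ofProjection hP hs).theta_eq, (q₁.isSplitting_ofProjection hQ hsQ).theta_eq]
  refine Quotient.sound (Splitting.equiv_of_contEnd hc hinj fun x v => ?_)
  rw [Splitting.ofProjection_proj, Splitting.ofProjection_proj]
  simp only [LinearMap.comp_apply, h₁]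

end Isometries

/-! ### From isomorphisms of frame bundles to isometries -/

section FrameMaps

set_option linter.unusedSectionVars false

variable {X : Type*} [TopologicalSpace X]
  {F : Type*} [NormedAddCommGroup F] [NormedSpace ℝ F] [FiniteDimensional ℝ F]
  {E : X → Type*} [TopologicalSpace (TotalSpace F E)]
  [∀ x, AddCommGroup (E x)] [∀ x, Module ℝ (E x)] {q q₀ q₁ : NondegQuadForm F E} {p m : ℕ}

/-- The basis of `E x` underlying an orthonormal frame over `x`. -/
def OrthoFrame.basisAt {x : X} (u : OrthoFrame q p m) (h : u.base = x) :
    Module.Basis (Fin p ⊕ Fin m) ℝ (E x) :=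
  h ▸ u.basis

theorem OrthoFrame.mk_basisAt {x : X} (u : OrthoFrame q p m) (h : u.base = x)
    (i : Fin p ⊕ Fin m) :
    (⟨x, u.basisAt h i⟩ : TotalSpace F E) = ⟨u.base, u.basis i⟩ := by
  subst h
  rfl

theorem OrthoFrame.bilin_basisAt {x : X} (u : OrthoFrame q p m) (h : u.base = x)
    (i j : Fin p ⊕ Fin m) :
    q.bilin x (u.basisAt h i) (u.basisAt h j) = signMatrix p m i j := by
  subst h
  exact u.orthonormal i j

theorem OrthoFrame.basisAt_smul {x : X} (u : OrthoFrame q p m) (h : u.base = x)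
    (g : indefiniteOrthogonalGroup p m) (h' : (MulOpposite.op g • u).base = x) :
    (MulOpposite.op g • u).basisAt h' = OrthoFrame.basisMul (u.basisAt h) g.1 := by
  subst h
  rfl

/-- Two orthonormal frames of a fibre differ by an element of `O(p, m)`. -/
theorem exists_basisMul_eq {x : X} {s ε : Module.Basis (Fin p ⊕ Fin m) ℝ (E x)}
    (hs : ∀ i j, q.bilin x (s i) (s j) = signMatrix p m i j)
    (hε : ∀ i j, q.bilin x (ε i) (ε j) = signMatrix p m i j) :
    ∃ g : indefiniteOrthogonalGroup p m, ε = OrthoFrame.basisMul s g.1 := by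
  let g : GL (Fin p ⊕ Fin m) ℝ := ⟨s.toMatrix ε, ε.toMatrix s, s.toMatrix_mul_toMatrix_flip ε,
    ε.toMatrix_mul_toMatrix_flip s⟩
  have hg : ∀ j, ε j = ∑ i, g.1 i j • s i := fun j => (s.sum_toMatrix_smul_self ε j).symm
  have hmem : g.1.transpose * signMatrix p m * g.1 = signMatrix p m := by
    ext i j
    rw [← hε i j, hg i, hg j]
    simp only [map_sum, map_smul, LinearMap.sum_apply, LinearMap.smul_apply, hs,
      Matrix.mul_apply, Matrix.transpose_apply, smul_eq_mul, Finset.sum_mul, Finset.mul_sum]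
    refine Finset.sum_congr rfl fun a _ => Finset.sum_congr rfl fun b _ => ?_
    ring
  exact ⟨⟨g, hmem⟩, Module.Basis.eq_of_apply_eq fun j => by
    rw [OrthoFrame.basisMul_apply]
    exact hg j⟩

/-- Coordinates in an orthonormal frame. -/
theorem repr_eq_of_orthonormal {x : X} {s : Module.Basis (Fin p ⊕ Fin m) ℝ (E x)}
    (hs : ∀ i j, q.bilin x (s i) (s j) = signMatrix p m i j) (v : E x) (i : Fin p ⊕ Fin m) :
    s.repr v i = signMatrix p m i i * q.bilin x v (s i) := by
  have h1 : q.bilin x v (s i) = s.repr v i * signMatrix p m i i := by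
    conv_lhs => rw [← s.sum_repr v]
    simp only [map_sum, map_smul, LinearMap.sum_apply, LinearMap.smul_apply, hs, smul_eq_mul]
    rw [Finset.sum_eq_single i (fun j _ hj => by
      simp [signMatrix, LieAlgebra.Orthogonal.indefiniteDiagonal, hj]) (by simp)]
  have h2 : signMatrix p m i i * signMatrix p m i i = 1 := by
    rcases i with i | i <;> simp [signMatrix, LieAlgebra.Orthogonal.indefiniteDiagonal]
  rw [h1, mul_comm, mul_assoc, h2, mul_one]

variable [∀ x, TopologicalSpace (E x)] [FiberBundle F E] [VectorBundle ℝ F E]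
  [ParacompactSpace X] [T2Space X]

/-- An isomorphism between bundles of orthonormal frames comes from a continuous isometry. -/
theorem exists_isometry_of_principalIso (h₀ : q₀.HasInertia p m)
    (Φ : PrincipalIso (indefiniteOrthogonalGroup p m)
      (OrthoFrame.base : OrthoFrame q₀ p m → X) (OrthoFrame.base : OrthoFrame q₁ p m → X)) :
    ∃ f : ∀ x, E x →ₗ[ℝ] E x, ContEnd F f ∧
      ∀ x v w, q₁.bilin x (f x v) (f x w) = q₀.bilin x v w := by
  have hex : ∀ x, ∃ s : Module.Basis (Fin p ⊕ Fin m) ℝ (E x), ∀ i j,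
      q₀.bilin x (s i) (s j) = signMatrix p m i j := fun x => by
    obtain ⟨s, hs, -⟩ := h₀.exists_frames x
    exact ⟨s x, hs x⟩
  choose s hs using hex
  let fr : ∀ x (ε : Module.Basis (Fin p ⊕ Fin m) ℝ (E x)),
      (∀ i j, q₀.bilin x (ε i) (ε j) = signMatrix p m i j) → OrthoFrame q₀ p m :=
    fun x ε hε => ⟨x, ε, hε⟩
  let t : ∀ x (ε : Module.Basis (Fin p ⊕ Fin m) ℝ (E x)),
      (∀ i j, q₀.bilin x (ε i) (ε j) = signMatrix p m i j) →
        Module.Basis (Fin p ⊕ Fin m) ℝ (E x) :=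
    fun x ε hε => (Φ.toHomeomorph (fr x ε hε)).basisAt (Φ.proj_comp _)
  -- The frames `s x` are chosen without any continuity in `x`.
  let f : ∀ x, E x →ₗ[ℝ] E x := fun x =>
    ((s x).equiv (t x (s x) (hs x)) (Equiv.refl _)).toLinearMap
  have hfs : ∀ x i, f x (s x i) = t x (s x) (hs x) i := fun x i => by simp [f]
  -- The frames over `x` form a single orbit, so equivariance and linearity make `f x` induce `Φ` on
  -- all of them. Continuity may then be tested on the better frames `s'`.
  have hft : ∀ x ε hε i, f x (ε i) = t x ε hε i := fun x ε hε i => by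
    obtain ⟨g, rfl⟩ := exists_basisMul_eq (hs x) hε
    have h1 : t x (OrthoFrame.basisMul (s x) g.1) hε =
        OrthoFrame.basisMul (t x (s x) (hs x)) g.1 := by
      have h2 : fr x (OrthoFrame.basisMul (s x) g.1) hε =
          MulOpposite.op g • fr x (s x) (hs x) := rfl
      have h3 := Φ.equivariant g (fr x (s x) (hs x))
      rw [← OrthoFrame.basisAt_smul _ _ g (Φ.proj_comp (fr x (s x) (hs x)))]
      simp only [t, h2, h3]
    rw [h1, OrthoFrame.basisMul_apply, OrthoFrame.basisMul_apply]
    simp only [map_sum, map_smul, hfs]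
  refine ⟨f, continuous_iff_continuousAt.2 fun v => ?_, fun x v w => ?_⟩
  · obtain ⟨s', hs', hc⟩ := h₀.exists_frames v.proj
    have hπ : ContinuousAt (TotalSpace.proj : TotalSpace F E → X) v :=
      (FiberBundle.continuous_proj F E).continuousAt
    have hsec : ContinuousAt (fun x => fr x (s' x) (hs' x)) v.proj :=
      (IsInducing.continuousAt_iff ⟨rfl⟩).2 (continuousAt_id.prodMk (continuousAt_pi.2 hc))
    have hΦ : ContinuousAt (fun x => Φ.toHomeomorph (fr x (s' x) (hs' x))) v.proj :=
      Φ.toHomeomorph.continuous.continuousAt.comp hsec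
    have hemb : Continuous fun u : OrthoFrame q₁ p m =>
        ((u.base, fun i => ⟨u.base, u.basis i⟩) : X × (Fin p ⊕ Fin m → TotalSpace F E)) :=
      continuous_induced_dom
    have ht : ∀ i, ContinuousAt
        (fun x => (⟨x, t x (s' x) (hs' x) i⟩ : TotalSpace F E)) v.proj := fun i => by
      have h1 := ((continuous_apply i).comp (continuous_snd.comp hemb)).continuousAt.comp hΦ
      refine h1.congr (Eventually.of_forall fun x => ?_)
      exact (OrthoFrame.mk_basisAt _ (Φ.proj_comp (fr x (s' x) (hs' x))) i).symm
    -- This is `f` expanded in the frame `s'`: the coordinates of `w` are `± q₀ (w, s' i)`, and the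
    -- images of the frame vectors are given by `Φ`.
    have hsum : ContinuousAt (fun w : TotalSpace F E => (⟨w.proj, ∑ i,
        (signMatrix p m i i * q₀.bilin w.proj w.snd (s' w.proj i)) •
          t w.proj (s' w.proj) (hs' w.proj) i⟩ : TotalSpace F E)) v :=
      continuousAt_mk_sum Finset.univ hπ fun i _ => continuousAt_mk_smul
        (continuousAt_const.mul (q₀.contForm.continuousAt_apply continuousAt_id
          (ContinuousAt.comp (f := TotalSpace.proj) (hc i) hπ)))
        (ContinuousAt.comp (f := TotalSpace.proj) (ht i) hπ)
    refine hsum.congr (Eventually.of_forall fun w => ?_)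
    refine congrArg (TotalSpace.mk w.proj) ?_
    conv_rhs => rw [← (s' w.proj).sum_repr w.snd]
    simp only [map_sum, map_smul, hft w.proj (s' w.proj) (hs' w.proj),
      repr_eq_of_orthonormal (hs' w.proj)]
  · have : (q₁.bilin x).compl₁₂ (f x) (f x) = q₀.bilin x :=
      LinearMap.BilinForm.ext_basis (s x) fun i j => by
        rw [LinearMap.compl₁₂_apply, hfs, hfs, hs]
        exact OrthoFrame.bilin_basisAt _ _ i j
    rw [← this, LinearMap.compl₁₂_apply]

end FrameMaps

end BundleSylvester

end

/-! ### The main theorem -/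

theorem proposition3p13 {X : Type*} [TopologicalSpace X] [ConnectedSpace X]
    [LocallyConnectedSpace X] [ParacompactSpace X] [T2Space X]
    {F : Type*} [NormedAddCommGroup F] [NormedSpace ℝ F] [FiniteDimensional ℝ F]
    {E : X → Type*} [TopologicalSpace (Bundle.TotalSpace F E)]
    [∀ x, AddCommGroup (E x)] [∀ x, Module ℝ (E x)]
    [∀ x, TopologicalSpace (E x)] [FiberBundle F E] [VectorBundle ℝ F E] :
    -- `theta q` is the isomorphism class of any `q`-splitting, and `q`-splittings exist
    (∀ q : BundleSylvester.NondegQuadForm F E,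
      (∃ S : BundleSylvester.Splitting F E, q.IsSplitting S) ∧
      ∀ S : BundleSylvester.Splitting F E, q.IsSplitting S → q.theta = Quotient.mk _ S) ∧
    ∀ q₀ q₁ : BundleSylvester.NondegQuadForm F E,
      q₀.theta = q₁.theta ↔ BundleSylvester.FrameBundlesIsomorphic q₀ q₁ := by
  refine ⟨fun q => ⟨q.exists_isSplitting, fun S hS => hS.theta_eq⟩, fun q₀ q₁ =>
    ⟨BundleSylvester.frameBundlesIsomorphic_of_theta_eq, ?_⟩⟩
  rintro ⟨p, m, h₀, -, ⟨Φ⟩⟩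
  obtain ⟨f, hc, hf⟩ := BundleSylvester.exists_isometry_of_principalIso h₀ Φ
  exact BundleSylvester.theta_eq_of_isometry hc hf
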